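/- **Setting.** For a set-valued operator $A\colon\mathcal H\to 2^{\mathcal H}$ on a real Hilbert space, $A^{-1}u=\{x: u\in Ax\}$, and $J_A=(\mathrm{Id}+A)^{-1}$ is the resolvent (single-valued and defined everywhere if $A$ is maximally monotone). A *modulus* is an increasing function $\phi\colon[0,+\infty[\,\to[0,+\infty]$ vanishing only at $0$. $A$ is *uniformly monotone at* $x$ with $Ax\neq\varnothing$ if there is a modulus $\phi$ with $\langle x-y,u-v\rangle\ge\phi(\|x-y\|)$ for all $u\in Ax$, all $y$ and all $v\in Ay$. Weak and strong convergence are written $\rightharpoonup$ and $\to$. Let $m,s\ge 1$ be integers. For $i\in\{1,\dots,m\}$ let $\mathcal H_i$ be a real Hilbert space, $z_i\in\mathcal H_i$, $A_i\colon\mathcal H_i\to2^{\mathcal H_i}$ maximally monotone, and $C_i\colon\mathcal H_1\times\dots\times\mathcal H_m\to\mathcal H_i$, where for some $\nu_0\in[0,+\infty[$ and all $x=(x_i)_i$, $y=(y_i)_i$ $$\sum_{i=1}^m\|C_ix-C_iy\|^2\le\nu_0^2\sum_{i=1}^m\|x_i-y_i\|^2,\qquad \sum_{i=1}^m\langle C_ix-C_iy,x_i-y_i\rangle\ge0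 .$$ For $k\in\{1,\dots,s\}$ let $\mathcal G_k,\mathcal Y_k,\mathcal X_k$ be real Hilbert spaces, $r_k\in\mathcal G_k$, $B_k\colon\mathcal Y_k\to2^{\mathcal Y_k}$ and $D_k\colon\mathcal X_k\to2^{\mathcal X_k}$ maximally monotone, and $M_k\colon\mathcal G_k\to\mathcal Y_k$, $N_k\colon\mathcal G_k\to\mathcal X_k$, $L_{k,i}\colon\mathcal H_i\to\mathcal G_k$ bounded linear operators. Let $\Omega$ be the set of all $(\overline x_1,\dots,\overline x_m,\overline v_1,\dots,\overline v_s)\in\mathcal H_1\times\dots\times\mathcal H_m\times\mathcal G_1\times\dots\times\mathcal G_s$ such that $$z_i-\sum_{k=1}^sL_{k,i}^*\overline v_k\in A_i\overline x_i+C_i(\overline x_1,\dots,\overline x_m)\quad(1\le i\le m),$$ $$\sum_{i=1}^mL_{k,i}\overline x_i-r_k\in(M_k^*\circ B_k\circ M_k)^{-1}\overline v_k+(N_k^*\circ D_k\circ N_k)^{-1}\overline v_k\quad(1\le k\le s).$$ **Theorem.** Suppose that $\Omega\neq\varnothing$ and that $$\beta=\nu_0+\sqrt{\sum_{i=1}^m\sum_{k=1}^s\|N_kL_{k,i}\|^2+\max_{1\le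 k\le s}(\|N_k\|^2+\|M_k\|^2)}>0 .$$ Let $(a^i_{1,1,n})_n,(b^i_{1,1,n})_n,(c^i_{1,1,n})_n$ in $\mathcal H_i$, $(a^k_{1,2,n})_n,(c^k_{1,2,n})_n$ in $\mathcal G_k$, $(a^k_{2,1,n})_n,(b^k_{2,1,n})_n,(c^k_{2,1,n})_n$ in $\mathcal X_k$ and $(a^k_{2,2,n})_n,(b^k_{2,2,n})_n,(c^k_{2,2,n})_n$ in $\mathcal Y_k$ be absolutely summable sequences. Let $\varepsilon\in\,]0,1/(\beta+1)[$ and let $(\gamma_n)_{n\in\mathbb N}$ be a sequence in $[\varepsilon,(1-\varepsilon)/\beta]$. Starting from arbitrary $x^i_{1,0}\in\mathcal H_i$, $x^k_{2,0}\in\mathcal G_k$, $v^k_{1,0}\in\mathcal X_k$, $v^k_{2,0}\in\mathcal Y_k$, let for every $n\in\mathbb N$, $i\in\{1,\dots,m\}$ and $k\in\{1,\dots,s\}$ $$\begin{aligned} s^i_{1,1,n}&=x^i_{1,n}-\gamma_n\Big(C_i(x^1_{1,n},\dots,x^m_{1,n})+\sum_{k=1}^sL_{k,i}^*N_k^*v^k_{1,n}+a^i_{1,1,n}\Big)\\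 p^i_{1,1,n}&=J_{\gamma_nA_i}(s^i_{1,1,n}+\gamma_nz_i)+b^i_{1,1,n}\\ p^k_{1,2,n}&=x^k_{2,n}+\gamma_n\big(N_k^*v^k_{1,n}-M_k^*v^k_{2,n}+a^k_{1,2,n}\big)\\ s^k_{2,1,n}&=v^k_{1,n}+\gamma_n\Big(\sum_{i=1}^mN_kL_{k,i}x^i_{1,n}-N_kx^k_{2,n}+a^k_{2,1,n}\Big)\\ p^k_{2,1,n}&=s^k_{2,1,n}-\gamma_n\big(N_kr_k+J_{\gamma_n^{-1}D_k}(\gamma_n^{-1}s^k_{2,1,n}-N_kr_k)+b^k_{2,1,n}\big)\\ q^k_{2,1,n}&=p^k_{2,1,n}+\gamma_n\Big(N_k\sum_{i=1}^mL_{k,i}p^i_{1,1,n}-N_kp^k_{1,2,n}+c^k_{2,1,n}\Big)\\ v^k_{1,n+1}&=v^k_{1,n}-s^k_{2,1,n}+q^k_{2,1,n}\\ s^k_{2,2,n}&=v^k_{2,n}+\gamma_n\big(M_kx^k_{2,n}+a^k_{2,2,n}\big)\\ p^k_{2,2,n}&=s^k_{2,2,n}-\gamma_n\big(J_{\gamma_n^{-1}B_k}(\gamma_n^{-1}s^k_{2,2,n})+b^k_{2,2,n}\big)\\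 q^k_{2,2,n}&=p^k_{2,2,n}+\gamma_n\big(M_kp^k_{1,2,n}+c^k_{2,2,n}\big)\\ v^k_{2,n+1}&=v^k_{2,n}-s^k_{2,2,n}+q^k_{2,2,n}\\ q^k_{1,2,n}&=p^k_{1,2,n}+\gamma_n\big(N_k^*p^k_{2,1,n}-M_k^*p^k_{2,2,n}+c^k_{1,2,n}\big)\\ x^k_{2,n+1}&=x^k_{2,n}-p^k_{1,2,n}+q^k_{1,2,n}\\ q^i_{1,1,n}&=p^i_{1,1,n}-\gamma_n\Big(C_i(p^1_{1,1,n},\dots,p^m_{1,1,n})+\sum_{k=1}^sL_{k,i}^*N_k^*p^k_{2,1,n}+c^i_{1,1,n}\Big)\\ x^i_{1,n+1}&=x^i_{1,n}-s^i_{1,1,n}+q^i_{1,1,n}. \end{aligned}$$ Then the following hold for all $i\in\{1,\dots,m\}$ and $k\in\{1,\dots,s\}$. 1. $\sum_{n}\|x^i_{1,n}-p^i_{1,1,n}\|^2<+\infty$ and $\sum_{n}\|x^k_{2,n}-p^k_{1,2,n}\|^2<+\infty$. 2. $\sum_{n}\|v^k_{1,n}-p^k_{2,1,n}\|^2<+\infty$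 and $\sum_{n}\|v^k_{2,n}-p^k_{2,2,n}\|^2<+\infty$. 3. There are $\overline x_{1,i}\in\mathcal H_i$, $\overline x_{2,k}\in\mathcal G_k$, $\overline v_{1,k}\in\mathcal X_k$, $\overline v_{2,k}\in\mathcal Y_k$ with $x^i_{1,n}\rightharpoonup\overline x_{1,i}$, $x^k_{2,n}\rightharpoonup\overline x_{2,k}$, $v^k_{1,n}\rightharpoonup\overline v_{1,k}$, $v^k_{2,n}\rightharpoonup\overline v_{2,k}$, such that $M_k^*\overline v_{2,k}=N_k^*\overline v_{1,k}$ and $(\overline x_{1,1},\dots,\overline x_{1,m},N_1^*\overline v_{1,1},\dots,N_s^*\overline v_{1,s})\in\Omega$. 4. If $A_j$ is uniformly monotone at $\overline x_{1,j}$ for some $j\in\{1,\dots,m\}$, then $x^j_{1,n}\to\overline x_{1,j}$. 5. If the operator $(x_i)_{1\le i\le m}\mapsto(C_j(x_1,\dots,x_m))_{1\le j\le m}$ on the Hilbert direct sum $\mathcal H_1\oplus\dots\oplus\mathcal H_m$ is uniformly monotone at $(\overline x_{1,1},\dots,\overline x_{1,m})$, then $x^i_{1,n}\to\overline x_{1,i}$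 for every $i\in\{1,\dots,m\}$. 6. If there are $j\in\{1,\dots,m\}$ and a modulus $\phi_j$ such that, for all $(x_i)_{1\le i\le m}\in\mathcal H_1\times\dots\times\mathcal H_m$, $$\sum_{i=1}^m\langle C_i(x_1,\dots,x_m)-C_i(\overline x_{1,1},\dots,\overline x_{1,m}),x_i-\overline x_{1,i}\rangle\ge\phi_j(\|x_j-\overline x_{1,j}\|),$$ then $x^j_{1,n}\to\overline x_{1,j}$. 7. If $D_j^{-1}$ is uniformly monotone at $\overline v_{1,j}$ for some $j\in\{1,\dots,s\}$, then $v^j_{1,n}\to\overline v_{1,j}$. 8. If $B_j^{-1}$ is uniformly monotone at $\overline v_{2,j}$ for some $j\in\{1,\dots,s\}$, then $v^j_{2,n}\to\overline v_{2,j}$. -/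

import Mathlib

open Filter Topology
open scoped NNReal ENNReal Pointwise

/-! ### Set-valued operators on a real Hilbert space -/

section Operators

variable {E F : Type*}
variable [NormedAddCommGroup E] [InnerProductSpace ℝ E]
variable [NormedAddCommGroup F] [InnerProductSpace ℝ F]

/-- The inverse `u ↦ {x | u ∈ A x}` of a set-valued operator. -/
def opInv (A : E → Set F) : F → Set E := fun u => {x | u ∈ A x}

/-- The graph of a set-valued operator. -/
def opGraph (A : E → Set F) : Set (E × F) := {p | p.2 ∈ A p.1}

/-- Monotonicity of a set-valued operator. -/
def IsMonotoneOp (A : E → Set E) : Prop :=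
  ∀ x y u v, u ∈ A x → v ∈ A y → 0 ≤ inner ℝ (x - y) (u - v)

/-- Maximal monotonicity: no monotone operator has a strictly larger graph. -/
def IsMaximallyMonotoneOp (A : E → Set E) : Prop :=
  IsMonotoneOp A ∧ ¬ ∃ B : E → Set E, IsMonotoneOp B ∧ opGraph A ⊂ opGraph B

/-- The (set-valued) resolvent `J_A = (Id + A)⁻¹`; it is everywhere defined and single-valued when
`A` is maximally monotone. -/
def opResolvent (A : E → Set E) : E → Set E := opInv (fun p => {p} + A p)

/-- An increasing function `[0, +∞[ → [0, +∞]` vanishing only at `0`. -/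
def IsModulus (φ : ℝ≥0 → ℝ≥0∞) : Prop :=
  Monotone φ ∧ ∀ t, φ t = 0 ↔ t = 0

/-- Uniform monotonicity of `A` at a point `x` of its domain. -/
def IsUniformlyMonotoneOpAt (A : E → Set E) (x : E) : Prop :=
  (A x).Nonempty ∧ ∃ φ : ℝ≥0 → ℝ≥0∞, IsModulus φ ∧
    ∀ u ∈ A x, ∀ y, ∀ v ∈ A y,
      (φ ‖x - y‖₊ : EReal) ≤ ((inner ℝ (x - y) (u - v) : ℝ) : EReal)

/-- The composite operator `M* ∘ B ∘ M`. -/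
noncomputable def opConj [CompleteSpace E] [CompleteSpace F] (M : E →L[ℝ] F) (B : F → Set F) :
    E → Set E :=
  fun y => M.adjoint '' B (M y)

/-- Weak convergence `u n ⇀ x` of a sequence. -/
def WeaklyConvergesTo (u : ℕ → E) (x : E) : Prop :=
  Tendsto (fun n => toWeakSpace ℝ E (u n)) atTop (𝓝 (toWeakSpace ℝ E x))

end Operators

/-! ### The system of composite inclusions and the algorithm -/

section System

variable {m s : ℕ} (H : Fin m → Type*) (G Y X : Fin s → Type*)
variable [∀ i, NormedAddCommGroup (H i)] [∀ i, InnerProductSpace ℝ (H i)]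
variable [∀ i, CompleteSpace (H i)]
variable [∀ k, NormedAddCommGroup (G k)] [∀ k, InnerProductSpace ℝ (G k)]
variable [∀ k, CompleteSpace (G k)]
variable [∀ k, NormedAddCommGroup (Y k)] [∀ k, InnerProductSpace ℝ (Y k)]
variable [∀ k, CompleteSpace (Y k)]
variable [∀ k, NormedAddCommGroup (X k)] [∀ k, InnerProductSpace ℝ (X k)]
variable [∀ k, CompleteSpace (X k)]

/-- The data of the coupled system of composite monotone inclusions, with the standing
assumptions on them. -/
structure CompositeSystem where
  z : ∀ i, H i
  A : ∀ i, H i → Set (H i)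
  C : ∀ i, (∀ j, H j) → H i
  ν₀ : ℝ
  r : ∀ k, G k
  B : ∀ k, Y k → Set (Y k)
  D : ∀ k, X k → Set (X k)
  M : ∀ k, G k →L[ℝ] Y k
  N : ∀ k, G k →L[ℝ] X k
  L : ∀ k i, H i →L[ℝ] G k
  A_maximal : ∀ i, IsMaximallyMonotoneOp (A i)
  B_maximal : ∀ k, IsMaximallyMonotoneOp (B k)
  D_maximal : ∀ k, IsMaximallyMonotoneOp (D k)
  ν₀_nonneg : 0 ≤ ν₀
  C_lipschitz : ∀ x y : ∀ j, H j,
    ∑ i, ‖C i x - C i y‖ ^ 2 ≤ ν₀ ^ 2 * ∑ i, ‖x i - y i‖ ^ 2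
  C_monotone : ∀ x y : ∀ j, H j, 0 ≤ ∑ i, inner ℝ (C i x - C i y) (x i - y i)

/-- The error sequences of the algorithm, each of them absolutely summable. -/
structure ErrorSequences where
  a₁₁ : ∀ i, ℕ → H i
  b₁₁ : ∀ i, ℕ → H i
  c₁₁ : ∀ i, ℕ → H i
  a₁₂ : ∀ k, ℕ → G k
  c₁₂ : ∀ k, ℕ → G k
  a₂₁ : ∀ k, ℕ → X k
  b₂₁ : ∀ k, ℕ → X k
  c₂₁ : ∀ k, ℕ → X k
  a₂₂ : ∀ k, ℕ → Y k
  b₂₂ : ∀ k, ℕ → Y k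
  c₂₂ : ∀ k, ℕ → Y k
  a₁₁_summable : ∀ i, Summable fun n => ‖a₁₁ i n‖
  b₁₁_summable : ∀ i, Summable fun n => ‖b₁₁ i n‖
  c₁₁_summable : ∀ i, Summable fun n => ‖c₁₁ i n‖
  a₁₂_summable : ∀ k, Summable fun n => ‖a₁₂ k n‖
  c₁₂_summable : ∀ k, Summable fun n => ‖c₁₂ k n‖
  a₂₁_summable : ∀ k, Summable fun n => ‖a₂₁ k n‖
  b₂₁_summable : ∀ k, Summable fun n => ‖b₂₁ k n‖
  c₂₁_summable : ∀ k, Summable fun n => ‖c₂₁ k n‖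
  a₂₂_summable : ∀ k, Summable fun n => ‖a₂₂ k n‖
  b₂₂_summable : ∀ k, Summable fun n => ‖b₂₂ k n‖
  c₂₂_summable : ∀ k, Summable fun n => ‖c₂₂ k n‖

/-- All the sequences produced by the algorithm (the laws are in `CompositeSystem.IsRun`). -/
structure Iterates where
  x₁ : ∀ i, ℕ → H i
  s₁₁ : ∀ i, ℕ → H i
  p₁₁ : ∀ i, ℕ → H i
  q₁₁ : ∀ i, ℕ → H i
  x₂ : ∀ k, ℕ → G k
  p₁₂ : ∀ k, ℕ → G k
  q₁₂ : ∀ k, ℕ → G k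
  v₁ : ∀ k, ℕ → X k
  s₂₁ : ∀ k, ℕ → X k
  p₂₁ : ∀ k, ℕ → X k
  q₂₁ : ∀ k, ℕ → X k
  v₂ : ∀ k, ℕ → Y k
  s₂₂ : ∀ k, ℕ → Y k
  p₂₂ : ∀ k, ℕ → Y k
  q₂₂ : ∀ k, ℕ → Y k

namespace CompositeSystem

variable {H G Y X}

/-- The set `Ω` of solutions `(x, v)` of the coupled system. -/
def Omega (P : CompositeSystem H G Y X) : Set ((∀ i, H i) × (∀ k, G k)) :=
  {w | (∀ i, P.z i - ∑ k, (P.L k i).adjoint (w.2 k) ∈ P.A i (w.1 i) + {P.C i w.1}) ∧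
    ∀ k, ∑ i, P.L k i (w.1 i) - P.r k ∈
      opInv (opConj (P.M k) (P.B k)) (w.2 k) + opInv (opConj (P.N k) (P.D k)) (w.2 k)}

/-- The constant `β` that governs the step sizes. -/
noncomputable def beta (P : CompositeSystem H G Y X) : ℝ :=
  P.ν₀ + √((∑ i, ∑ k, ‖(P.N k).comp (P.L k i)‖ ^ 2) + ⨆ k, (‖P.N k‖ ^ 2 + ‖P.M k‖ ^ 2))

/-- The operator `(xᵢ)ᵢ ↦ (Cᵢ x)ᵢ` on the Hilbert direct sum of the `H i`. -/
def jointC (P : CompositeSystem H G Y X) : PiLp 2 H → Set (PiLp 2 H) :=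
  fun x => {WithLp.toLp 2 fun i => P.C i x.ofLp}

/-- The sequences `T` are generated by the forward-backward-forward algorithm with step sizes `γ`
and errors `e`, from arbitrary starting points. -/
structure IsRun (P : CompositeSystem H G Y X) (e : ErrorSequences H G Y X) (γ : ℕ → ℝ)
    (T : Iterates H G Y X) : Prop where
  s₁₁_eq : ∀ n i, T.s₁₁ i n = T.x₁ i n - γ n • (P.C i (fun j => T.x₁ j n)
    + ∑ k, (P.L k i).adjoint ((P.N k).adjoint (T.v₁ k n)) + e.a₁₁ i n)
  p₁₁_eq : ∀ n i, ∃ w ∈ opResolvent (fun x => γ n • P.A i x) (T.s₁₁ i n + γ n • P.z i),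
    T.p₁₁ i n = w + e.b₁₁ i n
  p₁₂_eq : ∀ n k, T.p₁₂ k n = T.x₂ k n
    + γ n • ((P.N k).adjoint (T.v₁ k n) - (P.M k).adjoint (T.v₂ k n) + e.a₁₂ k n)
  s₂₁_eq : ∀ n k, T.s₂₁ k n = T.v₁ k n
    + γ n • (∑ i, P.N k (P.L k i (T.x₁ i n)) - P.N k (T.x₂ k n) + e.a₂₁ k n)
  p₂₁_eq : ∀ n k, ∃ w ∈ opResolvent (fun x => (γ n)⁻¹ • P.D k x)
      ((γ n)⁻¹ • T.s₂₁ k n - P.N k (P.r k)),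
    T.p₂₁ k n = T.s₂₁ k n - γ n • (P.N k (P.r k) + w + e.b₂₁ k n)
  q₂₁_eq : ∀ n k, T.q₂₁ k n = T.p₂₁ k n
    + γ n • (P.N k (∑ i, P.L k i (T.p₁₁ i n)) - P.N k (T.p₁₂ k n) + e.c₂₁ k n)
  v₁_succ : ∀ n k, T.v₁ k (n + 1) = T.v₁ k n - T.s₂₁ k n + T.q₂₁ k n
  s₂₂_eq : ∀ n k, T.s₂₂ k n = T.v₂ k n + γ n • (P.M k (T.x₂ k n) + e.a₂₂ k n)
  p₂₂_eq : ∀ n k, ∃ w ∈ opResolvent (fun x => (γ n)⁻¹ • P.B k x) ((γ n)⁻¹ • T.s₂₂ k n),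
    T.p₂₂ k n = T.s₂₂ k n - γ n • (w + e.b₂₂ k n)
  q₂₂_eq : ∀ n k, T.q₂₂ k n = T.p₂₂ k n + γ n • (P.M k (T.p₁₂ k n) + e.c₂₂ k n)
  v₂_succ : ∀ n k, T.v₂ k (n + 1) = T.v₂ k n - T.s₂₂ k n + T.q₂₂ k n
  q₁₂_eq : ∀ n k, T.q₁₂ k n = T.p₁₂ k n
    + γ n • ((P.N k).adjoint (T.p₂₁ k n) - (P.M k).adjoint (T.p₂₂ k n) + e.c₁₂ k n)
  x₂_succ : ∀ n k, T.x₂ k (n + 1) = T.x₂ k n - T.p₁₂ k n + T.q₁₂ k n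
  q₁₁_eq : ∀ n i, T.q₁₁ i n = T.p₁₁ i n - γ n • (P.C i (fun j => T.p₁₁ j n)
    + ∑ k, (P.L k i).adjoint ((P.N k).adjoint (T.p₂₁ k n)) + e.c₁₁ i n)
  x₁_succ : ∀ n i, T.x₁ i (n + 1) = T.x₁ i n - T.s₁₁ i n + T.q₁₁ i n

end CompositeSystem

end System

/-! ### Maximal monotonicity -/

/-! The system is one inclusion `0 ∈ M u + Q u` in the Hilbert sum of all variables `u = (x₁, x₂,
v₁, v₂)`. Splitting `∑ L x - r` into `x₂` and a remainder, and writing the dual variable as the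
common value `M* v₂ = N* v₁`, separates the parallel sums into independent rows. The set-valued part
`pdOp` is a product of shifted `A`, zero, shifted `D⁻¹` and `B⁻¹`, hence maximally monotone. The map
`pdMap` is `C` plus a skew linear coupling; skewness keeps it monotone, and it is `β`-Lipschitz.

For these data the algorithm is Tseng's forward-backward-forward method with summable errors, since
Moreau's decomposition converts the resolvents of `D` and `B` into backward steps for their
inverses. By `fbf_step_sq_le` an exact step does not increase the distance to any zero, and the
squared distance drops by a multiple of `‖x - p‖²`. Hence the iterates are quasi-Fejér and `‖x -
p‖²` is summable. The residual `u + Q p` then vanishes, so weak cluster points are zeros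
(`neg_mem_of_weak_limit`), and Opial's lemma leaves a single weak limit `z`.

For strong convergence, the pairing of `p - z` with the residual tends to `0` and splits into
nonnegative terms, one for each `A i`, `D k`, `B k` and one for `C`. Each term vanishes, so a
modulus below one of them forces norm convergence of the matching variable. -/

theorem isMaximallyMonotoneOp_iff {E : Type*} [NormedAddCommGroup E] [InnerProductSpace ℝ E]
    {A : E → Set E} :
    IsMaximallyMonotoneOp A ↔ IsMonotoneOp A ∧
      ∀ p q, (∀ y, ∀ w ∈ A y, 0 ≤ inner ℝ (p - y) (q - w)) → q ∈ A p := by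
  constructor
  · rintro ⟨hA, hmax⟩
    refine ⟨hA, fun p q h => ?_⟩
    by_contra hq
    -- Adjoining `(p, q)` to the graph keeps it monotone, which contradicts maximality.
    refine hmax ⟨fun y => {w | w ∈ A y ∨ (y = p ∧ w = q)}, ?_, ?_⟩
    · rintro x y u v (hu | ⟨rfl, rfl⟩) (hv | ⟨rfl, rfl⟩)
      · exact hA _ _ _ _ hu hv
      · have := h _ _ hu
        rwa [← neg_sub x, ← neg_sub u, inner_neg_neg] at this
      · exact h _ _ hv
      · simp
    · refine ⟨fun w hw => Or.inl hw, fun hsub => hq ?_⟩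
      exact hsub (a := (p, q)) (Or.inr ⟨rfl, rfl⟩)
  · rintro ⟨hA, hmax⟩
    refine ⟨hA, ?_⟩
    rintro ⟨B, hB, hsub, hnot⟩
    refine hnot ?_
    rintro ⟨p, q⟩ hpq
    exact hmax p q fun y w hw => hB _ _ _ _ hpq (hsub (a := (y, w)) hw)

/-- A graph point of `A` with nonpositive pairing against `(p, q)`, negative if `q ∉ A p`. -/
theorem IsMaximallyMonotoneOp.exists_inner_nonpos {E : Type*} [NormedAddCommGroup E]
    [InnerProductSpace ℝ E] {A : E → Set E} (hA : IsMaximallyMonotoneOp A) (p q : E) :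
    ∃ y, ∃ w ∈ A y, inner ℝ (p - y) (q - w) ≤ 0 ∧ (q ∉ A p → inner ℝ (p - y) (q - w) < 0) := by
  by_cases hq : q ∈ A p
  · exact ⟨p, q, hq, by simp, fun h => absurd hq h⟩
  · have h := mt ((isMaximallyMonotoneOp_iff.1 hA).2 p q) hq
    push Not at h
    obtain ⟨y, w, hw, h⟩ := h
    exact ⟨y, w, hw, h.le, fun _ => h⟩

/-! ### Weak convergence -/

section Weak

variable {K : Type*} [NormedAddCommGroup K] [InnerProductSpace ℝ K]

theorem tendsto_inner_of_weak_of_strong {ι : Type*} {F : Filter ι} {u w : ι → K} {R : ℝ} {x z : K}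
    (hu : ∀ n, ‖u n‖ ≤ R) (hux : ∀ y, Tendsto (fun n => inner ℝ y (u n)) F (𝓝 (inner ℝ y x)))
    (hw : Tendsto w F (𝓝 z)) :
    Tendsto (fun n => inner ℝ (w n) (u n)) F (𝓝 (inner ℝ z x)) := by
  have h0 : Tendsto (fun n => inner ℝ (w n - z) (u n)) F (𝓝 0) := by
    have h1 : Tendsto (fun n => ‖w n - z‖ * R) F (𝓝 0) := by
      simpa using (tendsto_iff_norm_sub_tendsto_zero.1 hw).mul_const R
    refine squeeze_zero_norm (fun n => ?_) h1
    exact (norm_inner_le_norm _ _).trans (mul_le_mul_of_nonneg_left (hu n) (norm_nonneg _))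
  simpa [inner_sub_left] using h0.add (hux z)

variable [CompleteSpace K]

theorem weaklyConvergesTo_iff_inner {u : ℕ → K} {x : K} :
    WeaklyConvergesTo u x ↔ ∀ y, Tendsto (fun n => inner ℝ y (u n)) atTop (𝓝 (inner ℝ y x)) := by
  unfold WeaklyConvergesTo
  have hinj : Function.Injective (topDualPairing ℝ K).flip := by
    intro a b hab
    exact ext_inner_left ℝ fun v => by
      simpa using DFunLike.congr_fun hab (InnerProductSpace.toDual ℝ K v)
  refine (WeakBilin.tendsto_iff_forall_eval_tendsto (B := (topDualPairing ℝ K).flip) hinj).trans ?_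
  constructor
  · intro h y
    exact h (InnerProductSpace.toDual ℝ K y)
  · intro h f
    obtain ⟨y, rfl⟩ := (InnerProductSpace.toDual ℝ K).surjective f
    exact h y

/-- Banach–Alaoglu read through the Riesz isomorphism. Ultrafilters replace subsequences, so every
further bounded quantity converges along the same filter. -/
theorem exists_weak_limit_ultrafilter {ι : Type*} (F : Ultrafilter ι) {u : ι → K} {R : ℝ}
    (hu : ∀ n, ‖u n‖ ≤ R) :
    ∃ x, ∀ y, Tendsto (fun n => inner ℝ y (u n)) F (𝓝 (inner ℝ y x)) := by
  let φ : ι → WeakDual ℝ K := fun n => StrongDual.toWeakDual (InnerProductSpace.toDual ℝ K (u n))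
  have hc := WeakDual.isCompact_closedBall (𝕜 := ℝ) (E := K) 0 R
  obtain ⟨f, -, hf⟩ := hc.ultrafilter_le_nhds (F.map φ) (by
    rw [Ultrafilter.coe_map, le_principal_iff, mem_map]
    refine Filter.univ_mem' fun n => ?_
    simpa [φ] using hu n)
  refine ⟨(InnerProductSpace.toDual ℝ K).symm (WeakDual.toStrongDual f), fun y => ?_⟩
  have h : Tendsto (fun n => φ n y) F (𝓝 (f y)) :=
    ((WeakDual.eval_continuous y).tendsto f).comp hf
  simp_rw [real_inner_comm _ y]
  simpa [φ] using h

theorem exists_limit_ultrafilter_of_abs_le {ι : Type*} (F : Ultrafilter ι) {t : ι → ℝ} {R : ℝ}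
    (ht : ∀ n, |t n| ≤ R) : ∃ a, Tendsto t F (𝓝 a) := by
  obtain ⟨a, -, ha⟩ := (isCompact_closedBall (0 : ℝ) R).ultrafilter_le_nhds (F.map t) (by
    rw [Ultrafilter.coe_map, le_principal_iff, mem_map]
    exact Filter.univ_mem' fun n => by simpa using ht n)
  exact ⟨a, ha⟩

/-- A Hilbert-space version of Opial's lemma. -/
theorem exists_weak_limit_of_fejer {Z : Set K} (hZ : Z.Nonempty) {x : ℕ → K}
    (hconv : ∀ z ∈ Z, ∃ l, Tendsto (fun n => ‖x n - z‖) atTop (𝓝 l))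
    (hclus : ∀ (F : Ultrafilter ℕ) (p : K), (F : Filter ℕ) ≤ atTop →
      (∀ y, Tendsto (fun n => inner ℝ y (x n)) F (𝓝 (inner ℝ y p))) → p ∈ Z) :
    ∃ p ∈ Z, ∀ y, Tendsto (fun n => inner ℝ y (x n)) atTop (𝓝 (inner ℝ y p)) := by
  obtain ⟨z, hz⟩ := hZ
  obtain ⟨R, hR⟩ : ∃ R, ∀ n, ‖x n‖ ≤ R := by
    obtain ⟨l, hl⟩ := hconv z hz
    obtain ⟨R, hR⟩ := hl.bddAbove_range
    refine ⟨R + ‖z‖, fun n => ?_⟩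
    have h1 := hR ⟨n, rfl⟩
    have h2 := norm_add_le (x n - z) z
    simp only [sub_add_cancel] at h2
    simp only at h1
    linarith
  -- The difference `‖x n - z₂‖² - ‖x n - z₁‖²` is affine in `x n`, with linear part `2⟨z₁ - z₂, x
  -- n⟩`.
  have hinner : ∀ z₁ ∈ Z, ∀ z₂ ∈ Z, ∃ l,
      Tendsto (fun n => inner ℝ (z₁ - z₂) (x n)) atTop (𝓝 l) := by
    intro z₁ h₁ z₂ h₂
    obtain ⟨l₁, hl₁⟩ := hconv z₁ h₁
    obtain ⟨l₂, hl₂⟩ := hconv z₂ h₂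
    refine ⟨_, ((((hl₂.pow 2).sub (hl₁.pow 2)).add_const (‖z₁‖ ^ 2 - ‖z₂‖ ^ 2)).div_const 2).congr
      fun n => ?_⟩
    rw [norm_sub_sq_real, norm_sub_sq_real, inner_sub_left, real_inner_comm z₁, real_inner_comm z₂]
    ring
  let F₀ : Ultrafilter ℕ := Ultrafilter.of atTop
  have hF₀ : (F₀ : Filter ℕ) ≤ atTop := Ultrafilter.of_le _
  obtain ⟨p, hp⟩ := exists_weak_limit_ultrafilter F₀ hR
  have hpZ := hclus F₀ p hF₀ hp
  refine ⟨p, hpZ, fun y => ?_⟩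
  rw [tendsto_iff_ultrafilter]
  intro F hF
  obtain ⟨q, hq⟩ := exists_weak_limit_ultrafilter F hR
  have hqZ := hclus F q hF hq
  obtain ⟨l, hl⟩ := hinner p hpZ q hqZ
  have e₁ := tendsto_nhds_unique (hp (p - q)) (hl.mono_left hF₀)
  have e₂ := tendsto_nhds_unique (hq (p - q)) (hl.mono_left hF)
  -- The pairing with `p - q` converges along the whole sequence, so its limits `⟨p - q, p⟩` and `⟨p
  -- - q, q⟩` agree.
  have : p - q = 0 := by
    rw [← inner_self_eq_zero (𝕜 := ℝ), inner_sub_right, e₁, e₂, sub_self]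
  rw [sub_eq_zero.1 this]
  exact hq y

end Weak

/-! ### Quasi-Fejér sequences of reals -/

/-- Subtracting the partial sums of the errors leaves a decreasing sequence bounded below. -/
theorem exists_tendsto_of_le_add_summable {X e : ℕ → ℝ} (hX : ∀ n, 0 ≤ X n)
    (he : Summable e) (h : ∀ n, X (n + 1) ≤ X n + e n) : ∃ l, Tendsto X atTop (𝓝 l) := by
  have hS := he.hasSum.tendsto_sum_nat
  have hanti : Antitone fun n => X n - ∑ k ∈ Finset.range n, e k := by
    refine antitone_nat_of_succ_le fun n => ?_
    rw [Finset.sum_range_succ]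
    linarith [h n]
  obtain ⟨R, hR⟩ := hS.bddAbove_range
  have hbdd : BddBelow (Set.range fun n => X n - ∑ k ∈ Finset.range n, e k) := by
    refine ⟨-R, ?_⟩
    rintro _ ⟨n, rfl⟩
    have := hR ⟨n, rfl⟩
    simp only at this ⊢
    linarith [hX n]
  refine ⟨_, ((tendsto_atTop_ciInf hanti hbdd).add hS).congr fun n => by simp⟩

theorem summable_of_le_sub_add_summable {X d e : ℕ → ℝ} (hX : ∀ n, 0 ≤ X n) (hd : ∀ n, 0 ≤ d n)
    (he : Summable e) (h : ∀ n, d n ≤ X n - X (n + 1) + e n) : Summable d := by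
  obtain ⟨R, hR⟩ := he.hasSum.tendsto_sum_nat.bddAbove_range
  refine summable_of_sum_range_le (c := X 0 + R) hd fun n => ?_
  have h1 := Finset.sum_le_sum fun k (_ : k ∈ Finset.range n) => h k
  rw [Finset.sum_add_distrib, Finset.sum_range_sub'] at h1
  have := hR ⟨n, rfl⟩
  simp only at this
  linarith [hX n]

theorem summable_sq_of_summable_norm {E : Type*} [SeminormedAddCommGroup E] {b : ℕ → E}
    (hb : Summable fun n => ‖b n‖) : Summable fun n => ‖b n‖ ^ 2 := by
  obtain ⟨R, hR⟩ := hb.tendsto_atTop_zero.bddAbove_range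
  refine Summable.of_nonneg_of_le (fun n => by positivity) (fun n => ?_) (hb.mul_left R)
  have := hR ⟨n, rfl⟩
  rw [sq]
  exact mul_le_mul_of_nonneg_right this (norm_nonneg _)

/-! ### The forward-backward-forward iteration in a Hilbert space -/

section ForwardBackwardForward

variable {K : Type*} [NormedAddCommGroup K] [InnerProductSpace ℝ K]

/-- A continuous monotone map is determined by its monotone relation to a point. -/
theorem eq_of_forall_inner_nonneg_of_continuous {Q : K → K} (hQ : Continuous Q) {p q : K}
    (h : ∀ y, 0 ≤ inner ℝ (p - y) (q - Q y)) : q = Q p := by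
  -- Minty's trick: test at `p + τ (q - Q p)`, divide by `τ`, and let `τ` tend to `0`.
  have hle : ∀ τ : ℝ, 0 < τ → inner ℝ (q - Q p) (q - Q (p + τ • (q - Q p))) ≤ 0 := by
    intro τ hτ
    have := h (p + τ • (q - Q p))
    rw [sub_add_cancel_left, inner_neg_left, real_inner_smul_left] at this
    by_contra! hc
    have := mul_pos hτ hc
    linarith
  have hcont : Continuous fun τ : ℝ => inner ℝ (q - Q p) (q - Q (p + τ • (q - Q p))) := by
    fun_prop
  have hlim := (hcont.tendsto 0).mono_left (nhdsWithin_le_nhds (s := Set.Ioi 0))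
  have h0 := le_of_tendsto hlim (eventually_nhdsWithin_of_forall hle)
  simp only [zero_smul, add_zero] at h0
  rw [real_inner_self_eq_norm_sq] at h0
  exact sub_eq_zero.1 (norm_eq_zero.1 (
    pow_eq_zero_iff two_ne_zero |>.1 (le_antisymm h0 (sq_nonneg _))))

/-- Weak limits of approximate zeros of `M + Q` are zeros of `M + Q`. -/
theorem neg_mem_of_weak_limit [CompleteSpace K] {M : K → Set K} (hM : IsMaximallyMonotoneOp M)
    {Q : K → K} {β : ℝ} (hQm : ∀ x y, 0 ≤ inner ℝ (x - y) (Q x - Q y))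
    (hQL : ∀ x y, ‖Q x - Q y‖ ≤ β * ‖x - y‖) {ι : Type*} (F : Ultrafilter ι) {p u : ι → K}
    {p₀ : K} {R : ℝ} (hR : ∀ n, ‖p n‖ ≤ R)
    (hu : ∀ n, u n ∈ M (p n))
    (hp : ∀ y, Tendsto (fun n => inner ℝ y (p n)) F (𝓝 (inner ℝ y p₀)))
    (hz : Tendsto (fun n => u n + Q (p n)) F (𝓝 0)) : -Q p₀ ∈ M p₀ := by
  have hβ : ∀ x y, ‖Q x - Q y‖ ≤ |β| * ‖x - y‖ := fun x y =>
    (hQL x y).trans (mul_le_mul_of_nonneg_right (le_abs_self β) (norm_nonneg _))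
  have hQc : Continuous Q := by
    refine (LipschitzWith.of_dist_le_mul (K := ⟨|β|, abs_nonneg β⟩) fun x y => ?_).continuous
    rw [dist_eq_norm, dist_eq_norm]
    exact hβ x y
  have hQb : ∀ n, ‖Q (p n)‖ ≤ |β| * R + ‖Q 0‖ := fun n => by
    have h1 := hβ (p n) 0
    have h2 := norm_add_le (Q (p n) - Q 0) (Q 0)
    rw [sub_add_cancel] at h2
    rw [sub_zero] at h1
    have h3 := mul_le_mul_of_nonneg_left (hR n) (abs_nonneg β)
    linarith
  -- Let `q` be the weak limit of `Q (p n)` and `t` the limit of `⟨p n, Q (p n)⟩`. A priori `t` need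
  -- not equal `⟨p₀, q⟩`; the two monotonicity relations will force equality without using
  -- maximality of `M + Q`.
  obtain ⟨q, hq⟩ := exists_weak_limit_ultrafilter F hQb
  obtain ⟨t, ht⟩ := exists_limit_ultrafilter_of_abs_le F (t := fun n => inner ℝ (p n) (Q (p n)))
    (R := R * (|β| * R + ‖Q 0‖)) fun n => (abs_real_inner_le_norm _ _).trans
      (mul_le_mul (hR n) (hQb n) (norm_nonneg _) ((norm_nonneg _).trans (hR n)))
  have huy : ∀ y, Tendsto (fun n => inner ℝ y (u n)) F (𝓝 (-inner ℝ y q)) := by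
    intro y
    have h1 : Tendsto (fun n => inner ℝ y (u n + Q (p n))) F (𝓝 (inner ℝ y 0)) :=
      tendsto_const_nhds.inner hz
    simpa [inner_add_right] using h1.sub (hq y)
  have hpu : Tendsto (fun n => inner ℝ (p n) (u n)) F (𝓝 (-t)) := by
    have h1 := tendsto_inner_of_weak_of_strong hR hp hz
    simp_rw [real_inner_comm (p _)] at h1
    simpa [inner_add_right] using h1.sub ht
  have hMrel : ∀ y, ∀ w ∈ M y, 0 ≤ -t - inner ℝ w p₀ + inner ℝ y q + inner ℝ y w := by
    intro y w hw
    have h1 : Tendsto (fun n => inner ℝ (p n) (u n) - inner ℝ w (p n) - inner ℝ y (u n)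
        + inner ℝ y w) F (𝓝 (-t - inner ℝ w p₀ - -inner ℝ y q + inner ℝ y w)) :=
      ((hpu.sub (hp w)).sub (huy y)).add_const _
    rw [sub_neg_eq_add] at h1
    refine ge_of_tendsto' h1 fun n => ?_
    have := hM.1 _ _ _ _ (hu n) hw
    rw [inner_sub_left, inner_sub_right, inner_sub_right, real_inner_comm w] at this
    linarith
  have hQrel : ∀ y, 0 ≤ t - inner ℝ (Q y) p₀ - inner ℝ y q + inner ℝ y (Q y) := by
    intro y
    have h1 : Tendsto (fun n => inner ℝ (p n) (Q (p n)) - inner ℝ (Q y) (p n)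
        - inner ℝ y (Q (p n)) + inner ℝ y (Q y)) F
        (𝓝 (t - inner ℝ (Q y) p₀ - inner ℝ y q + inner ℝ y (Q y))) :=
      ((ht.sub (hp (Q y))).sub (hq y)).add_const _
    refine ge_of_tendsto' h1 fun n => ?_
    have := hQm (p n) y
    rw [inner_sub_left, inner_sub_right, inner_sub_right, real_inner_comm (Q y)] at this
    linarith
  -- Monotonicity of `Q` against `p₀` bounds `t` below, which is what relates `(p₀, -q)`
  -- monotonically to the graph of `M`.
  have ht₁ : inner ℝ p₀ q ≤ t := by
    have := hQrel p₀
    rw [real_inner_comm p₀] at this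
    linarith
  have hqM : -q ∈ M p₀ := by
    refine (isMaximallyMonotoneOp_iff.1 hM).2 p₀ (-q) fun y w hw => ?_
    have := hMrel y w hw
    simp only [inner_sub_left, inner_sub_right, inner_neg_right]
    rw [real_inner_comm w p₀]
    linarith
  -- Now `-q ∈ M p₀` is itself an admissible test point, and it gives the reverse bound on `t`.
  have ht₂ : t ≤ inner ℝ p₀ q := by
    have := hMrel p₀ (-q) hqM
    rw [inner_neg_left, inner_neg_right, real_inner_comm p₀] at this
    linarith
  have hqQ : q = Q p₀ := eq_of_forall_inner_nonneg_of_continuous hQc fun y => by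
    have := hQrel y
    simp only [inner_sub_left, inner_sub_right]
    rw [real_inner_comm (Q y) p₀]
    linarith
  rwa [← hqQ]

/-- The Fejér estimate for one forward-backward-forward step with an error `a` in the first
evaluation of `Q`. -/
theorem fbf_step_sq_le {M : K → Set K} (hM : IsMonotoneOp M) {Q : K → K} {β : ℝ}
    (hQm : ∀ x y, 0 ≤ inner ℝ (x - y) (Q x - Q y))
    (hQL : ∀ x y, ‖Q x - Q y‖ ≤ β * ‖x - y‖) {ε γ : ℝ} (hγ : 0 ≤ γ) (hγβ : γ * β ≤ 1 - ε)
    {x p u a z : K} (hu : u ∈ M p) (hz : -Q z ∈ M z)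
    (hs : x - γ • (Q x + a) = p + γ • u) :
    ‖p + γ • (Q x - Q p) - z‖ ^ 2 ≤
      ‖x - z‖ ^ 2 - (1 - (1 - ε) ^ 2) * ‖x - p‖ ^ 2 + 2 * (γ * ‖a‖) * (‖x - z‖ + ‖x - p‖) := by
  have h1 := hM _ _ _ _ hu hz
  have h2 := hQm p z
  -- Both `u` against `-Q z` and `Q p` against `Q z` pair nonnegatively with `p - z`; the `Q z`
  -- terms cancel.
  have h3 : 0 ≤ inner ℝ (p - z) (γ • (u + Q p)) := by
    rw [real_inner_smul_right]
    refine mul_nonneg hγ ?_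
    have : u + Q p = (u - -Q z) + (Q p - Q z) := by abel
    rw [this, inner_add_right]
    exact add_nonneg h1 h2
  set d := Q x - Q p with hd
  have h4 : γ • (u + Q p) = (x - p) - γ • d - γ • a := by
    rw [hd]
    have : γ • u = x - γ • (Q x + a) - p := by rw [hs]; abel
    rw [smul_add, this, smul_add, smul_sub]
    abel
  rw [h4] at h3
  have h5 : ‖γ • d‖ ≤ (1 - ε) * ‖x - p‖ := by
    rw [norm_smul, Real.norm_of_nonneg hγ]
    calc γ * ‖d‖ ≤ γ * (β * ‖x - p‖) := mul_le_mul_of_nonneg_left (hQL x p) hγ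
      _ = γ * β * ‖x - p‖ := by ring
      _ ≤ _ := mul_le_mul_of_nonneg_right hγβ (norm_nonneg _)
  have h6 : ‖γ • d‖ ^ 2 ≤ (1 - ε) ^ 2 * ‖x - p‖ ^ 2 := by
    rw [← mul_pow]
    exact pow_le_pow_left₀ (norm_nonneg _) h5 2
  have h7 : inner ℝ (p - z) (γ • a) ≥ -(γ * ‖a‖) * (‖x - z‖ + ‖x - p‖) := by
    have e1 := (abs_le.1 (abs_real_inner_le_norm (p - z) (γ • a))).1
    have e2 : ‖p - z‖ ≤ ‖x - z‖ + ‖x - p‖ := by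
      have : p - z = (x - z) - (x - p) := by abel
      rw [this]
      exact norm_sub_le _ _
    have e3 := mul_le_mul_of_nonneg_right e2 (norm_nonneg (γ • a))
    rw [norm_smul, Real.norm_of_nonneg hγ] at e1 e3
    linarith
  -- An exact identity: up to the error `a` its last inner product is nonnegative by `h3`, and `‖γ •
  -- d‖²` takes back only the fraction `(1 - ε)²` of `‖x - p‖²`.
  have h8 : ‖p + γ • d - z‖ ^ 2 = ‖x - z‖ ^ 2 - ‖x - p‖ ^ 2 + ‖γ • d‖ ^ 2
      - 2 * inner ℝ (p - z) ((x - p) - γ • d) := by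
    have e1 : p + γ • d - z = (p - z) + γ • d := by abel
    have e2 : x - z = (p - z) + (x - p) := by abel
    rw [e1, e2, norm_add_sq_real, norm_add_sq_real, inner_sub_right (p - z) (x - p)]
    ring
  rw [inner_sub_right] at h3
  rw [h8]
  linarith

/-- Young's inequality spends half of `δ d²` on the term `2ηd`. What remains fits in a square
because `2 / δ ≥ 1`, so a square root later yields an additive error. -/
theorem quasi_fejer_of_sq_le {δ X d η Y : ℝ} (hδ : 0 < δ) (hδ1 : δ ≤ 1) (hX : 0 ≤ X) (hη : 0 ≤ η)
    (h : Y ^ 2 ≤ X ^ 2 - δ * d ^ 2 + 2 * η * (X + d)) :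
    Y ^ 2 ≤ (X + 2 / δ * η) ^ 2 - δ / 2 * d ^ 2 := by
  have h1 : 2 * η * d ≤ δ / 2 * d ^ 2 + 2 / δ * η ^ 2 := by
    have e : δ / 2 * d ^ 2 + 2 / δ * η ^ 2 - 2 * η * d = (δ * d - 2 * η) ^ 2 / (2 * δ) := by
      field_simp
      ring
    have : 0 ≤ (δ * d - 2 * η) ^ 2 / (2 * δ) := by positivity
    linarith
  have h2 : 1 ≤ 2 / δ := by rw [le_div_iff₀ hδ]; linarith
  nlinarith [mul_nonneg hη hX, mul_nonneg (mul_nonneg hη hX) (sub_nonneg.2 h2), sq_nonneg η,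
    mul_nonneg (sq_nonneg η) (mul_nonneg (by positivity : (0 : ℝ) ≤ 2 / δ) (sub_nonneg.2 h2))]

/-- Convergence of the forward-backward-forward iteration with summable errors, for finding a zero
of `M + Q`. -/
theorem forward_backward_forward [CompleteSpace K] {M : K → Set K} (hM : IsMaximallyMonotoneOp M)
    {Q : K → K} {β : ℝ} (hQm : ∀ x y, 0 ≤ inner ℝ (x - y) (Q x - Q y))
    (hQL : ∀ x y, ‖Q x - Q y‖ ≤ β * ‖x - y‖) (hzer : ∃ z, -Q z ∈ M z)
    {ε Γ : ℝ} (hε : 0 < ε) (hε1 : ε ≤ 1) {γ : ℕ → ℝ} (hγ : ∀ n, ε ≤ γ n) (hγΓ : ∀ n, γ n ≤ Γ)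
    (hγβ : ∀ n, γ n * β ≤ 1 - ε) {x p u a b c : ℕ → K}
    (ha : Summable fun n => ‖a n‖) (hb : Summable fun n => ‖b n‖) (hc : Summable fun n => ‖c n‖)
    (hu : ∀ n, u n ∈ M (p n)) (hs : ∀ n, x n - γ n • (Q (x n) + a n) = p n + γ n • u n)
    (hx : ∀ n, x (n + 1) = γ n • (Q (x n) + a n) + (p n + b n)
      - γ n • (Q (p n + b n) + c n)) :
    (Summable fun n => ‖x n - (p n + b n)‖ ^ 2) ∧ Tendsto (fun n => x n - p n) atTop (𝓝 0) ∧
    ∃ z, -Q z ∈ M z ∧ (∀ y, Tendsto (fun n => inner ℝ y (x n)) atTop (𝓝 (inner ℝ y z))) ∧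
      Tendsto (fun n => inner ℝ (p n - z) (u n + Q (p n))) atTop (𝓝 0) := by
  have hγ0 : ∀ n, 0 ≤ γ n := fun n => hε.le.trans (hγ n)
  set δ : ℝ := 1 - (1 - ε) ^ 2 with hδdef
  have hδ : 0 < δ := by nlinarith
  have hδ1 : δ ≤ 1 := by nlinarith [sq_nonneg (1 - ε)]
  set err : ℕ → ℝ := fun n => 2 / δ * (Γ * ‖a n‖) + (Γ * ‖a n‖ + 2 * ‖b n‖ + Γ * ‖c n‖) with herr
  have hΓ : 0 ≤ Γ := (hγ0 0).trans (hγΓ 0)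
  have herr0 : ∀ n, 0 ≤ err n := fun n => by positivity
  have herrS : Summable err := ((ha.mul_left Γ).mul_left _).add
    (((ha.mul_left Γ).add (hb.mul_left 2)).add (hc.mul_left Γ))
  -- The actual iterate differs from the exact step by a summable amount. One `‖b n‖` is direct; the
  -- other comes from evaluating `Q` at `p n + b n`, where `γ n * β ≤ 1` absorbs the Lipschitz
  -- constant.
  have hx' : ∀ n, ‖x (n + 1) - (p n + γ n • (Q (x n) - Q (p n)))‖ ≤
      Γ * ‖a n‖ + 2 * ‖b n‖ + Γ * ‖c n‖ := by
    intro n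
    have e1 : x (n + 1) - (p n + γ n • (Q (x n) - Q (p n))) =
        γ n • a n + b n - γ n • (Q (p n + b n) - Q (p n)) - γ n • c n := by
      rw [hx]
      simp only [smul_add, smul_sub]
      abel
    have e2 : ‖γ n • (Q (p n + b n) - Q (p n))‖ ≤ ‖b n‖ := by
      rw [norm_smul, Real.norm_of_nonneg (hγ0 n)]
      have := hQL (p n + b n) (p n)
      rw [add_sub_cancel_left] at this
      have h1 := mul_le_mul_of_nonneg_left this (hγ0 n)
      have h2 := mul_le_mul_of_nonneg_right (hγβ n) (norm_nonneg (b n))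
      nlinarith [norm_nonneg (b n)]
    have e3 : ‖γ n • a n‖ ≤ Γ * ‖a n‖ := by
      rw [norm_smul, Real.norm_of_nonneg (hγ0 n)]
      exact mul_le_mul_of_nonneg_right (hγΓ n) (norm_nonneg _)
    have e4 : ‖γ n • c n‖ ≤ Γ * ‖c n‖ := by
      rw [norm_smul, Real.norm_of_nonneg (hγ0 n)]
      exact mul_le_mul_of_nonneg_right (hγΓ n) (norm_nonneg _)
    rw [e1]
    have i1 := norm_sub_le (γ n • a n + b n - γ n • (Q (p n + b n) - Q (p n))) (γ n • c n)
    have i2 := norm_sub_le (γ n • a n + b n) (γ n • (Q (p n + b n) - Q (p n)))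
    have i3 := norm_add_le (γ n • a n) (b n)
    linarith
  have hstep : ∀ z, -Q z ∈ M z → ∀ n, ‖p n + γ n • (Q (x n) - Q (p n)) - z‖ ^ 2 ≤
      (‖x n - z‖ + 2 / δ * (Γ * ‖a n‖)) ^ 2 - δ / 2 * ‖x n - p n‖ ^ 2 := by
    intro z hz n
    refine quasi_fejer_of_sq_le hδ hδ1 (norm_nonneg _) (by positivity) ?_
    have h1 := fbf_step_sq_le hM.1 hQm hQL (hγ0 n) (hγβ n) (hu n) hz (hs n)
    refine h1.trans ?_
    have h2 : γ n * ‖a n‖ ≤ Γ * ‖a n‖ := mul_le_mul_of_nonneg_right (hγΓ n) (norm_nonneg _)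
    have h3 := mul_le_mul_of_nonneg_right h2 (add_nonneg (norm_nonneg (x n - z))
      (norm_nonneg (x n - p n)))
    linarith
  have hnext : ∀ z n, ‖x (n + 1) - z‖ ≤ ‖p n + γ n • (Q (x n) - Q (p n)) - z‖ +
      (Γ * ‖a n‖ + 2 * ‖b n‖ + Γ * ‖c n‖) := by
    intro z n
    have h1 := norm_add_le (p n + γ n • (Q (x n) - Q (p n)) - z)
      (x (n + 1) - (p n + γ n • (Q (x n) - Q (p n))))
    rw [sub_add_sub_cancel'] at h1
    linarith [hx' n]
  have hfej : ∀ z, -Q z ∈ M z → ∀ n, ‖x (n + 1) - z‖ ≤ ‖x n - z‖ + err n := by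
    intro z hz n
    have h1 : ‖p n + γ n • (Q (x n) - Q (p n)) - z‖ ≤ ‖x n - z‖ + 2 / δ * (Γ * ‖a n‖) := by
      refine le_of_sq_le_sq ((hstep z hz n).trans ?_) (by positivity)
      have : 0 ≤ δ / 2 * ‖x n - p n‖ ^ 2 := by positivity
      linarith
    have h2 := hnext z n
    simp only [herr]
    linarith
  have hconv : ∀ z, -Q z ∈ M z → ∃ l, Tendsto (fun n => ‖x n - z‖) atTop (𝓝 l) := fun z hz =>
    exists_tendsto_of_le_add_summable (fun n => norm_nonneg _) herrS (hfej z hz)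
  obtain ⟨z₀, hz₀⟩ := hzer
  obtain ⟨R, hR⟩ : ∃ R, ∀ n, ‖x n - z₀‖ ≤ R := by
    obtain ⟨l, hl⟩ := hconv z₀ hz₀
    obtain ⟨R, hR⟩ := hl.bddAbove_range
    exact ⟨R, fun n => hR ⟨n, rfl⟩⟩
  obtain ⟨R', hR'⟩ : ∃ R', ∀ n, err n ≤ R' := by
    obtain ⟨R, hR⟩ := herrS.tendsto_atTop_zero.bddAbove_range
    exact ⟨R, fun n => hR ⟨n, rfl⟩⟩
  -- The step estimate is telescoped at one fixed zero. The bounds `R` on the distances and `R'` on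
  -- the errors make the cross terms of the square linear in `err n`, hence summable.
  have hdS : Summable fun n => ‖x n - p n‖ ^ 2 := by
    have h1 : Summable fun n => δ / 2 * ‖x n - p n‖ ^ 2 := by
      refine summable_of_le_sub_add_summable (X := fun n => ‖x n - z₀‖ ^ 2)
        (e := fun n => (2 * R + R') * err n) (fun n => by positivity) (fun n => by positivity)
        (herrS.mul_left _) fun n => ?_
      set t := 2 / δ * (Γ * ‖a n‖) with ht
      set r := Γ * ‖a n‖ + 2 * ‖b n‖ + Γ * ‖c n‖ with hr
      have ht0 : 0 ≤ t := by positivity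
      have hr0 : 0 ≤ r := by positivity
      have he : err n = t + r := rfl
      have h2 := hstep z₀ hz₀ n
      rw [← ht] at h2
      have h3 := hnext z₀ n
      have h4 := hR n
      have h5 := hR' n
      set Y := ‖p n + γ n • (Q (x n) - Q (p n)) - z₀‖
      have hY0 : 0 ≤ Y := norm_nonneg _
      have hX0 := norm_nonneg (x n - z₀)
      set X := ‖x n - z₀‖
      have hYX : Y ≤ X + t := by
        refine le_of_sq_le_sq (h2.trans ?_) (by positivity)
        have : 0 ≤ δ / 2 * ‖x n - p n‖ ^ 2 := by positivity
        linarith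
      have h6 : ‖x (n + 1) - z₀‖ ^ 2 ≤ (Y + r) ^ 2 := pow_le_pow_left₀ (norm_nonneg _) h3 2
      rw [he] at h5 ⊢
      have h7 := mul_le_mul_of_nonneg_right hYX hr0
      have h8 := mul_le_mul_of_nonneg_right h4 (add_nonneg ht0 hr0)
      have h9 := mul_le_mul_of_nonneg_right h5 (add_nonneg ht0 hr0)
      linear_combination h2 + h6 + 2 * h7 + 2 * h8 + h9
    refine (h1.mul_left (2 / δ)).congr fun n => ?_
    field_simp
  have hd0 : Tendsto (fun n => x n - p n) atTop (𝓝 0) := by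
    rw [tendsto_zero_iff_norm_tendsto_zero]
    have := hdS.tendsto_atTop_zero.sqrt
    simpa using this
  have hres : Tendsto (fun n => u n + Q (p n)) atTop (𝓝 0) := by
    have hlim : Tendsto (fun n => ε⁻¹ * ‖x n - p n‖ + β * ‖x n - p n‖ + ‖a n‖) atTop (𝓝 0) := by
      have h := tendsto_zero_iff_norm_tendsto_zero.1 hd0
      simpa using ((h.const_mul ε⁻¹).add (h.const_mul β)).add ha.tendsto_atTop_zero
    refine squeeze_zero_norm (fun n => ?_) hlim
    have hγn : 0 < γ n := hε.trans_le (hγ n)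
    -- Solving the backward step for `u n` expresses the residual through `x n - p n` and `a n`;
    -- here `γ n ≥ ε` keeps `(γ n)⁻¹` bounded.
    have e1 : u n + Q (p n) = (γ n)⁻¹ • (x n - p n) - (Q (x n) - Q (p n)) - a n := by
      have : γ n • u n = (x n - p n) - γ n • (Q (x n) + a n) := by
        rw [sub_right_comm, hs n]; abel
      have h2 : u n = (γ n)⁻¹ • ((x n - p n) - γ n • (Q (x n) + a n)) := by
        rw [← this, inv_smul_smul₀ hγn.ne']
      rw [h2, smul_sub, inv_smul_smul₀ hγn.ne']
      abel
    rw [e1]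
    have i1 := norm_sub_le ((γ n)⁻¹ • (x n - p n) - (Q (x n) - Q (p n))) (a n)
    have i2 := norm_sub_le ((γ n)⁻¹ • (x n - p n)) (Q (x n) - Q (p n))
    have i3 := hQL (x n) (p n)
    have i4 : ‖(γ n)⁻¹ • (x n - p n)‖ ≤ ε⁻¹ * ‖x n - p n‖ := by
      rw [norm_smul, Real.norm_of_nonneg (by positivity)]
      exact mul_le_mul_of_nonneg_right (inv_anti₀ hε (hγ n)) (norm_nonneg _)
    linarith
  have hxb : ∃ R, ∀ n, ‖x n‖ ≤ R := ⟨R + ‖z₀‖, fun n => by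
    have := norm_add_le (x n - z₀) z₀
    rw [sub_add_cancel] at this
    linarith [hR n]⟩
  obtain ⟨Rx, hRx⟩ := hxb
  obtain ⟨Rd, hRd⟩ := (tendsto_zero_iff_norm_tendsto_zero.1 hd0).bddAbove_range
  have hpb : ∀ n, ‖p n‖ ≤ Rx + Rd := fun n => by
    have h1 := norm_sub_le (x n) (x n - p n)
    rw [sub_sub_cancel] at h1
    have h2 : ‖x n - p n‖ ≤ Rd := hRd ⟨n, rfl⟩
    linarith [hRx n]
  have hweak : ∀ {F : Filter ℕ} {z y : K}, F ≤ atTop →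
      Tendsto (fun n => inner ℝ y (x n)) F (𝓝 (inner ℝ y z)) →
      Tendsto (fun n => inner ℝ y (p n)) F (𝓝 (inner ℝ y z)) := by
    intro F z y hF h
    have h1 : Tendsto (fun n => inner ℝ y (x n - p n)) F (𝓝 (inner ℝ y 0)) :=
      tendsto_const_nhds.inner (hd0.mono_left hF)
    simpa [inner_sub_right] using h.sub h1
  refine ⟨?_, hd0, ?_⟩
  · refine Summable.of_nonneg_of_le (fun n => by positivity) (fun n => ?_)
      ((hdS.mul_left 2).add ((summable_sq_of_summable_norm hb).mul_left 2))
    have h1 : ‖x n - (p n + b n)‖ ≤ ‖x n - p n‖ + ‖b n‖ := by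
      rw [← sub_sub]
      exact norm_sub_le _ _
    have h2 := pow_le_pow_left₀ (norm_nonneg _) h1 2
    nlinarith [sq_nonneg (‖x n - p n‖ - ‖b n‖)]
  · obtain ⟨z, hz, hxz⟩ := exists_weak_limit_of_fejer (Z := {z | -Q z ∈ M z}) ⟨z₀, hz₀⟩ hconv
      fun F z hF hFz => neg_mem_of_weak_limit hM hQm hQL F hpb hu
        (fun y => hweak hF (hFz y)) (hres.mono_left hF)
    refine ⟨z, hz, hxz, ?_⟩
    refine squeeze_zero_norm (a := fun n => (Rx + Rd + ‖z‖) * ‖u n + Q (p n)‖) (fun n => ?_) ?_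
    · refine (norm_inner_le_norm _ _).trans (mul_le_mul_of_nonneg_right ?_ (norm_nonneg _))
      exact (norm_sub_le _ _).trans (by linarith [hpb n])
    · simpa using (tendsto_zero_iff_norm_tendsto_zero.1 hres).const_mul (Rx + Rd + ‖z‖)

end ForwardBackwardForward

/-! ### Constructions of maximally monotone operators -/

section Constructions

/-- The operator `x ↦ A x - z`. -/
def opShift {E : Type*} [AddCommGroup E] (A : E → Set E) (z : E) : E → Set E :=
  fun x => {w | w + z ∈ A x}

/-- The product of a finite family of operators, on the Hilbert direct sum. -/
def opPi {ι : Type*} {E : ι → Type*} (A : ∀ i, E i → Set (E i)) : PiLp 2 E → Set (PiLp 2 E) :=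
  fun x => {w | ∀ i, w i ∈ A i (x i)}

/-- The product of two operators, on the Hilbert direct sum. -/
def opProd {E F : Type*} (A : E → Set E) (B : F → Set F) :
    WithLp 2 (E × F) → Set (WithLp 2 (E × F)) :=
  fun x => {w | w.fst ∈ A x.fst ∧ w.snd ∈ B x.snd}

variable {E F : Type*} [NormedAddCommGroup E] [InnerProductSpace ℝ E]
  [NormedAddCommGroup F] [InnerProductSpace ℝ F]

theorem IsMaximallyMonotoneOp.shift {A : E → Set E} (hA : IsMaximallyMonotoneOp A) (z : E) :
    IsMaximallyMonotoneOp (opShift A z) := by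
  rw [isMaximallyMonotoneOp_iff] at hA ⊢
  refine ⟨fun x y u v hu hv => ?_, fun p q h => hA.2 p (q + z) fun y w hw => ?_⟩
  · simpa using hA.1 _ _ _ _ hu hv
  · have := h y (w - z) (by simpa [opShift] using hw)
    rwa [sub_sub_eq_add_sub] at this

theorem IsMaximallyMonotoneOp.inv {A : E → Set E} (hA : IsMaximallyMonotoneOp A) :
    IsMaximallyMonotoneOp (opInv A) := by
  rw [isMaximallyMonotoneOp_iff] at hA ⊢
  refine ⟨fun x y u v hu hv => ?_, fun p q h => hA.2 q p fun y w hw => ?_⟩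
  · rw [real_inner_comm]
    exact hA.1 _ _ _ _ hu hv
  · rw [real_inner_comm]
    exact h w y hw

theorem isMaximallyMonotoneOp_zero : IsMaximallyMonotoneOp fun _ : E => ({0} : Set E) := by
  rw [isMaximallyMonotoneOp_iff]
  refine ⟨fun x y u v hu hv => ?_, fun p q h => ?_⟩
  · rw [Set.mem_singleton_iff] at hu hv
    simp [hu, hv]
  -- The test point `p + q` turns the relation into `0 ≤ -‖q‖²`.
  · have := h (p + q) 0 rfl
    rw [sub_add_cancel_left, sub_zero, inner_neg_left, real_inner_self_eq_norm_sq] at this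
    have h2 : ‖q‖ ^ 2 = 0 := le_antisymm (by linarith) (sq_nonneg _)
    simpa using h2

/-- If one coordinate fails membership, choose there a graph point with negative pairing and
elsewhere points with nonpositive pairing. Their sum violates the monotone relation; no resolvent or
surjectivity argument is involved. -/
theorem IsMaximallyMonotoneOp.pi {ι : Type*} [Fintype ι] {E : ι → Type*}
    [∀ i, NormedAddCommGroup (E i)] [∀ i, InnerProductSpace ℝ (E i)]
    {A : ∀ i, E i → Set (E i)} (hA : ∀ i, IsMaximallyMonotoneOp (A i)) :
    IsMaximallyMonotoneOp (opPi A) := by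
  rw [isMaximallyMonotoneOp_iff]
  refine ⟨fun x y u v hu hv => ?_, fun p q h => ?_⟩
  · rw [PiLp.inner_apply]
    exact Finset.sum_nonneg fun i _ => (hA i).1 _ _ _ _ (hu i) (hv i)
  · choose y w hw hle hlt using fun i => (hA i).exists_inner_nonpos (p i) (q i)
    by_contra hq
    obtain ⟨i, hi⟩ : ∃ i, q i ∉ A i (p i) := not_forall.1 hq
    have h1 := h (WithLp.toLp 2 y) (WithLp.toLp 2 w) hw
    rw [PiLp.inner_apply] at h1
    exact h1.not_gt (Finset.sum_neg' (fun i _ => hle i) ⟨i, Finset.mem_univ i, hlt i hi⟩)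

theorem IsMaximallyMonotoneOp.prod {A : E → Set E} {B : F → Set F}
    (hA : IsMaximallyMonotoneOp A) (hB : IsMaximallyMonotoneOp B) :
    IsMaximallyMonotoneOp (opProd A B) := by
  rw [isMaximallyMonotoneOp_iff]
  refine ⟨fun x y u v hu hv => ?_, fun p q h => ?_⟩
  · rw [WithLp.prod_inner_apply]
    exact add_nonneg (hA.1 _ _ _ _ hu.1 hv.1) (hB.1 _ _ _ _ hu.2 hv.2)
  · obtain ⟨y₁, w₁, hw₁, hle₁, hlt₁⟩ := hA.exists_inner_nonpos p.fst q.fst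
    obtain ⟨y₂, w₂, hw₂, hle₂, hlt₂⟩ := hB.exists_inner_nonpos p.snd q.snd
    have h1 : 0 ≤ inner ℝ (p.fst - y₁) (q.fst - w₁) + inner ℝ (p.snd - y₂) (q.snd - w₂) :=
      h (WithLp.toLp 2 (y₁, y₂)) (WithLp.toLp 2 (w₁, w₂)) ⟨hw₁, hw₂⟩
    constructor
    · by_contra hq
      linarith [hlt₁ hq]
    · by_contra hq
      linarith [hlt₂ hq]

end Constructions

/-! ### Moduli and weak limits under linear maps -/

theorem tendsto_zero_of_isModulus {E : Type*} [SeminormedAddCommGroup E] {φ : ℝ≥0 → ℝ≥0∞}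
    (hφ : IsModulus φ) {v : ℕ → E} {t : ℕ → ℝ} (ht : Tendsto t atTop (𝓝 0))
    (h : ∀ n, (φ ‖v n‖₊ : EReal) ≤ ((t n : ℝ) : EReal)) : Tendsto v atTop (𝓝 0) := by
  rw [Metric.tendsto_nhds]
  intro δ hδ
  lift δ to ℝ≥0 using hδ.le
  have hpos : (0 : EReal) < (φ δ : EReal) := by
    rw [EReal.coe_ennreal_pos, pos_iff_ne_zero, Ne, hφ.2, ← NNReal.coe_eq_zero]
    exact hδ.ne'
  -- The value `φ δ` may be `+∞`, so a positive real below it serves as threshold for `t n`.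
  obtain ⟨r, hr0, hr⟩ := EReal.lt_iff_exists_real_btwn.1 hpos
  filter_upwards [ht.eventually_lt_const (EReal.coe_pos.1 hr0)] with n hn
  rw [dist_zero_right]
  by_contra! hc
  have h1 : φ δ ≤ φ ‖v n‖₊ := hφ.1 (by exact_mod_cast hc)
  have h2 := (EReal.coe_ennreal_le_coe_ennreal_iff.2 h1).trans (h n)
  exact absurd (EReal.coe_lt_coe_iff.1 (hr.trans_le h2)) hn.not_gt

theorem weaklyConvergesTo_map {K E : Type*} [NormedAddCommGroup K] [InnerProductSpace ℝ K]
    [CompleteSpace K] [NormedAddCommGroup E] [InnerProductSpace ℝ E] [CompleteSpace E]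
    {x : ℕ → K} {z : K} (h : ∀ y, Tendsto (fun n => inner ℝ y (x n)) atTop (𝓝 (inner ℝ y z)))
    (f : K →L[ℝ] E) : WeaklyConvergesTo (fun n => f (x n)) (f z) := by
  rw [weaklyConvergesTo_iff_inner]
  intro y
  simpa [ContinuousLinearMap.adjoint_inner_left] using h (f.adjoint y)

theorem tendsto_of_uniformlyMonotoneOpAt {E : Type*} [NormedAddCommGroup E]
    [InnerProductSpace ℝ E] {A : E → Set E} {z u : E} (hA : IsUniformlyMonotoneOpAt A z)
    (hu : u ∈ A z) {p w : ℕ → E} (hw : ∀ n, w n ∈ A (p n))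
    (h : Tendsto (fun n => inner ℝ (p n - z) (w n - u)) atTop (𝓝 0)) :
    Tendsto p atTop (𝓝 z) := by
  obtain ⟨-, φ, hφ, hm⟩ := hA
  rw [tendsto_iff_norm_sub_tendsto_zero, ← tendsto_zero_iff_norm_tendsto_zero]
  refine tendsto_zero_of_isModulus hφ h fun n => ?_
  have := hm u hu (p n) (w n) (hw n)
  rwa [← neg_sub (p n), ← neg_sub (w n), inner_neg_neg, nnnorm_neg] at this

/-! ### The primal-dual space and the coupling operator -/

/-- The scalar inequality behind `β`. The cross term `2√κ X ∑ a t` is at most `κ X² + (∑ a t)²`, and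
Cauchy–Schwarz on the last square supplies exactly the two products missing on the right. -/
theorem sum_coupling_sq_le {ι : Type*} [Fintype ι] {a n m t : ι → ℝ} {X κ : ℝ}
    (ha : ∀ k, 0 ≤ a k) (ht : ∀ k, 0 ≤ t k) (hX : 0 ≤ X)
    (hκ : ∀ k, n k ^ 2 + m k ^ 2 ≤ κ) (hκ0 : 0 ≤ κ) :
    ∑ k, (a k * X + n k * t k) ^ 2 + ∑ k, (m k * t k) ^ 2 ≤
      (∑ k, a k ^ 2 + κ) * (X ^ 2 + ∑ k, t k ^ 2) := by
  have h1 : ∑ k, (a k * X + n k * t k) ^ 2 + ∑ k, (m k * t k) ^ 2 ≤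
      (∑ k, a k ^ 2) * X ^ 2 + 2 * (√κ * X) * (∑ k, a k * t k) + κ * ∑ k, t k ^ 2 := by
    rw [Finset.sum_mul, Finset.mul_sum, Finset.mul_sum, ← Finset.sum_add_distrib,
      ← Finset.sum_add_distrib, ← Finset.sum_add_distrib]
    refine Finset.sum_le_sum fun k _ => ?_
    have e1 : n k ≤ √κ := Real.le_sqrt_of_sq_le (by linarith [hκ k, sq_nonneg (m k)])
    have e2 := mul_le_mul_of_nonneg_right e1 (mul_nonneg hX (mul_nonneg (ha k) (ht k)))
    have e3 := mul_le_mul_of_nonneg_right (hκ k) (sq_nonneg (t k))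
    linear_combination 2 * e2 + e3
  have h2 := Finset.sum_mul_sq_le_sq_mul_sq Finset.univ a t
  have h3 := sq_nonneg (√κ * X - ∑ k, a k * t k)
  have h4 := Real.sq_sqrt hκ0
  have h5 : (√κ * X) ^ 2 = κ * X ^ 2 := by rw [mul_pow, h4]
  linear_combination h1 + h2 + h3 + h5

section System

variable {m s : ℕ} {H : Fin m → Type*} {G Y X : Fin s → Type*}
variable [∀ i, NormedAddCommGroup (H i)] [∀ i, InnerProductSpace ℝ (H i)]
variable [∀ k, NormedAddCommGroup (G k)] [∀ k, InnerProductSpace ℝ (G k)]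
variable [∀ k, NormedAddCommGroup (Y k)] [∀ k, InnerProductSpace ℝ (Y k)]
variable [∀ k, NormedAddCommGroup (X k)] [∀ k, InnerProductSpace ℝ (X k)]

/-- The Hilbert direct sum of two Hilbert direct sums. -/
abbrev PairSpace {I J : Type*} (U : I → Type*) (V : J → Type*) := WithLp 2 (PiLp 2 U × PiLp 2 V)

/-- The vector of a `PairSpace` with given components. -/
abbrev pairMk {I J : Type*} {U : I → Type*} {V : J → Type*} (u : ∀ i, U i) (v : ∀ j, V j) :
    PairSpace U V := WithLp.toLp 2 (WithLp.toLp 2 u, WithLp.toLp 2 v)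

/-- The Hilbert space of the primal-dual variables `(x₁, x₂, v₁, v₂)`. -/
abbrev PrimalDual (H : Fin m → Type*) (G Y X : Fin s → Type*) :=
  WithLp 2 (PairSpace H G × PairSpace X Y)

/-- The primal-dual vector with given components. -/
abbrev pdMk (x₁ : ∀ i, H i) (x₂ : ∀ k, G k) (v₁ : ∀ k, X k) (v₂ : ∀ k, Y k) :
    PrimalDual H G Y X := WithLp.toLp 2 (pairMk x₁ x₂, pairMk v₁ v₂)


namespace CompositeSystem

variable (P : CompositeSystem H G Y X)

/-- The linear coupling `(x₁, x₂) ↦ (N (L x₁) - N x₂, M x₂)`. -/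
def coupling (x : PairSpace H G) : PairSpace X Y :=
  pairMk (fun k => P.N k (∑ i, P.L k i (x.fst i)) - P.N k (x.snd k)) fun k => P.M k (x.snd k)

/-- The set-valued part of the primal-dual inclusion. -/
def pdOp : PrimalDual H G Y X → Set (PrimalDual H G Y X) :=
  opProd (opProd (opPi fun i => opShift (P.A i) (P.z i)) fun _ => {0})
    (opProd (opPi fun k => opShift (opInv (P.D k)) (-P.N k (P.r k))) (opPi fun k => opInv (P.B k)))

theorem isMaximallyMonotoneOp_pdOp : IsMaximallyMonotoneOp P.pdOp :=
  ((IsMaximallyMonotoneOp.pi fun i => (P.A_maximal i).shift _).prod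
    isMaximallyMonotoneOp_zero).prod
    ((IsMaximallyMonotoneOp.pi fun k => (P.D_maximal k).inv.shift _).prod
      (IsMaximallyMonotoneOp.pi fun k => (P.B_maximal k).inv))

theorem mem_pdOp_iff {u w : PrimalDual H G Y X} :
    w ∈ P.pdOp u ↔ ((∀ i, w.fst.fst i + P.z i ∈ P.A i (u.fst.fst i)) ∧ (∀ k, w.fst.snd k = 0)) ∧
      (∀ k, u.snd.fst k ∈ P.D k (w.snd.fst k - P.N k (P.r k))) ∧
      ∀ k, u.snd.snd k ∈ P.B k (w.snd.snd k) := by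
  have h : w.fst.snd = 0 ↔ ∀ k, w.fst.snd k = 0 := by
    rw [← WithLp.ofLp_eq_zero (p := 2), funext_iff]
    rfl
  simp only [sub_eq_add_neg, ← h]
  rfl

/-- The bound on the norm of the coupling. -/
noncomputable def couplingBound : ℝ :=
  √((∑ i, ∑ k, ‖(P.N k).comp (P.L k i)‖ ^ 2) + ⨆ k, (‖P.N k‖ ^ 2 + ‖P.M k‖ ^ 2))

theorem couplingBound_nonneg : 0 ≤ P.couplingBound := Real.sqrt_nonneg _

theorem norm_coupling_le (x : PairSpace H G) : ‖P.coupling x‖ ≤ P.couplingBound * ‖x‖ := by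
  set κ : ℝ := ⨆ k, (‖P.N k‖ ^ 2 + ‖P.M k‖ ^ 2) with hκdef
  have hκ0 : 0 ≤ κ := Real.iSup_nonneg fun k => by positivity
  have hκ : ∀ k, ‖P.N k‖ ^ 2 + ‖P.M k‖ ^ 2 ≤ κ := fun k =>
    le_ciSup (f := fun k => ‖P.N k‖ ^ 2 + ‖P.M k‖ ^ 2) (Set.finite_range _).bddAbove k
  set a : Fin s → ℝ := fun k => √(∑ i, ‖(P.N k).comp (P.L k i)‖ ^ 2) with ha
  have ha2 : ∀ k, a k ^ 2 = ∑ i, ‖(P.N k).comp (P.L k i)‖ ^ 2 := fun k =>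
    Real.sq_sqrt (Finset.sum_nonneg fun i _ => sq_nonneg _)
  have hX : ‖x.fst‖ ^ 2 = ∑ i, ‖x.fst i‖ ^ 2 := PiLp.norm_sq_eq_of_L2 _ _
  have h1 : ∀ k, ‖P.N k (∑ i, P.L k i (x.fst i)) - P.N k (x.snd k)‖ ≤
      a k * ‖x.fst‖ + ‖P.N k‖ * ‖x.snd k‖ := by
    intro k
    refine (norm_sub_le _ _).trans (add_le_add ?_ ((P.N k).le_opNorm _))
    rw [map_sum]
    calc ‖∑ i, P.N k (P.L k i (x.fst i))‖
        ≤ ∑ i, ‖(P.N k).comp (P.L k i)‖ * ‖x.fst i‖ :=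
          norm_sum_le_of_le _ fun i _ => ((P.N k).comp (P.L k i)).le_opNorm _
      _ ≤ √(∑ i, ‖(P.N k).comp (P.L k i)‖ ^ 2) * √(∑ i, ‖x.fst i‖ ^ 2) :=
          Real.sum_mul_le_sqrt_mul_sqrt _ _ _
      _ = a k * ‖x.fst‖ := by rw [← hX, Real.sqrt_sq (norm_nonneg _)]
  have h2 : ‖P.coupling x‖ ^ 2 ≤ (∑ k, a k ^ 2 + κ) * ‖x‖ ^ 2 := by
    rw [WithLp.prod_norm_sq_eq_of_L2, WithLp.prod_norm_sq_eq_of_L2 x,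
      PiLp.norm_sq_eq_of_L2 _ (P.coupling x).fst, PiLp.norm_sq_eq_of_L2 _ (P.coupling x).snd,
      PiLp.norm_sq_eq_of_L2 _ x.snd]
    refine le_trans (add_le_add (Finset.sum_le_sum fun k _ => ?_)
      (Finset.sum_le_sum fun k _ => ?_)) (sum_coupling_sq_le (a := a) (fun k => Real.sqrt_nonneg _)
        (fun k => norm_nonneg (x.snd k)) (norm_nonneg x.fst) hκ hκ0)
    · exact pow_le_pow_left₀ (norm_nonneg _) (h1 k) 2
    · exact pow_le_pow_left₀ (norm_nonneg _) ((P.M k).le_opNorm _) 2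
  have h3 : ∑ k, a k ^ 2 = ∑ i, ∑ k, ‖(P.N k).comp (P.L k i)‖ ^ 2 := by
    simp_rw [ha2]
    exact Finset.sum_comm
  rw [h3] at h2
  refine le_of_sq_le_sq (h2.trans_eq ?_) (mul_nonneg (Real.sqrt_nonneg _) (norm_nonneg _))
  rw [mul_pow, couplingBound, Real.sq_sqrt]
  exact add_nonneg (Finset.sum_nonneg fun i _ => Finset.sum_nonneg fun k _ => sq_nonneg _) hκ0

variable [∀ i, CompleteSpace (H i)]
variable [∀ k, CompleteSpace (G k)]
variable [∀ k, CompleteSpace (Y k)]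
variable [∀ k, CompleteSpace (X k)]

/-- The adjoint of the linear coupling. -/
noncomputable def couplingAdj (v : PairSpace X Y) : PairSpace H G :=
  pairMk (fun i => ∑ k, (P.L k i).adjoint ((P.N k).adjoint (v.fst k)))
    fun k => (P.M k).adjoint (v.snd k) - (P.N k).adjoint (v.fst k)

/-- The single-valued part `(x, v) ↦ (C x₁ + T* v, -T x)` of the primal-dual inclusion. -/
noncomputable def pdMap (u : PrimalDual H G Y X) : PrimalDual H G Y X :=
  WithLp.toLp 2 (pairMk (fun i => P.C i u.fst.fst.ofLp) 0 + P.couplingAdj u.snd,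
    -P.coupling u.fst)

/-- This identity makes the coupling part of `pdMap` skew; additivity of both maps and the bound for
the adjoint are also drawn from it. -/
theorem inner_coupling (x : PairSpace H G) (v : PairSpace X Y) :
    inner ℝ (P.coupling x) v = inner ℝ x (P.couplingAdj v) := by
  have h : ∑ i, ∑ k, inner ℝ (P.N k (P.L k i (x.fst i))) (v.fst k) =
      ∑ k, ∑ i, inner ℝ (P.N k (P.L k i (x.fst i))) (v.fst k) := Finset.sum_comm
  simp only [coupling, couplingAdj, pairMk, WithLp.prod_inner_apply, PiLp.inner_apply,
    inner_sub_left, inner_sub_right, inner_sum, sum_inner, map_sum,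
    ContinuousLinearMap.adjoint_inner_right, Finset.sum_sub_distrib]
  simp only [WithLp.fst, WithLp.snd] at h ⊢
  rw [h]
  ring

theorem coupling_sub (x y : PairSpace H G) :
    P.coupling (x - y) = P.coupling x - P.coupling y := by
  refine ext_inner_right ℝ fun v => ?_
  simp only [inner_sub_left, inner_coupling]

theorem couplingAdj_sub (v w : PairSpace X Y) :
    P.couplingAdj (v - w) = P.couplingAdj v - P.couplingAdj w := by
  refine ext_inner_left ℝ fun x => ?_
  simp only [inner_sub_right, ← inner_coupling]

theorem norm_couplingAdj_le (v : PairSpace X Y) :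
    ‖P.couplingAdj v‖ ≤ P.couplingBound * ‖v‖ := by
  have h1 : ‖P.couplingAdj v‖ * ‖P.couplingAdj v‖ ≤
      P.couplingBound * ‖v‖ * ‖P.couplingAdj v‖ := by
    rw [← real_inner_self_eq_norm_mul_norm, ← inner_coupling]
    refine (real_inner_le_norm _ _).trans ?_
    -- The bound on the coupling is used at `T* v` itself, in `‖T* v‖² = ⟨T T* v, v⟩`.
    have := mul_le_mul_of_nonneg_right (P.norm_coupling_le (P.couplingAdj v)) (norm_nonneg v)
    linarith
  by_cases h0 : ‖P.couplingAdj v‖ = 0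
  · rw [h0]
    exact mul_nonneg P.couplingBound_nonneg (norm_nonneg _)
  · exact le_of_mul_le_mul_right h1 (lt_of_le_of_ne (norm_nonneg _) (Ne.symm h0))

theorem pdMap_sub (x y : PrimalDual H G Y X) :
    P.pdMap x - P.pdMap y =
      WithLp.toLp 2 (pairMk (fun i => P.C i x.fst.fst.ofLp - P.C i y.fst.fst.ofLp) 0, 0) +
        WithLp.toLp 2 (P.couplingAdj (x - y).snd, -P.coupling (x - y).fst) := by
  rw [WithLp.sub_fst, WithLp.sub_snd, coupling_sub, couplingAdj_sub]
  refine WithLp.ofLp_injective 2 (Prod.ext ?_ ?_)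
  · change (pairMk (fun i => P.C i x.fst.fst.ofLp) 0 + P.couplingAdj x.snd) -
      (pairMk (fun i => P.C i y.fst.fst.ofLp) 0 + P.couplingAdj y.snd) =
      pairMk (fun i => P.C i x.fst.fst.ofLp - P.C i y.fst.fst.ofLp) 0 +
        (P.couplingAdj x.snd - P.couplingAdj y.snd)
    rw [add_sub_add_comm]
    congr 1
    refine WithLp.ofLp_injective 2 (Prod.ext rfl ?_)
    exact sub_self (0 : PiLp 2 G)
  · change -P.coupling x.fst - -P.coupling y.fst = 0 + -(P.coupling x.fst - P.coupling y.fst)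
    abel

/-- The skew coupling cancels, leaving only `C`. The equality gives monotonicity and later isolates
the `C` term for strong convergence. -/
theorem inner_pdMap_sub (x y : PrimalDual H G Y X) :
    inner ℝ (x - y) (P.pdMap x - P.pdMap y) =
      ∑ i, inner ℝ (P.C i x.fst.fst.ofLp - P.C i y.fst.fst.ofLp) (x.fst.fst i - y.fst.fst i) := by
  rw [pdMap_sub, inner_add_right]
  have h1 : inner ℝ (x - y) (WithLp.toLp 2 (P.couplingAdj (x - y).snd, -P.coupling (x - y).fst))
      = 0 := by
    rw [WithLp.prod_inner_apply]
    change inner ℝ (x - y).fst (P.couplingAdj (x - y).snd) +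
      inner ℝ (x - y).snd (-P.coupling (x - y).fst) = 0
    rw [inner_neg_right, ← inner_coupling, real_inner_comm, add_neg_cancel]
  have h2 : inner ℝ (x - y) (WithLp.toLp 2
      (pairMk (fun i => P.C i x.fst.fst.ofLp - P.C i y.fst.fst.ofLp) (0 : ∀ k, G k),
        (0 : PairSpace X Y))) =
      ∑ i, inner ℝ (x.fst.fst i - y.fst.fst i) (P.C i x.fst.fst.ofLp - P.C i y.fst.fst.ofLp) := by
    simp only [WithLp.prod_inner_apply, PiLp.inner_apply, pairMk, Pi.zero_apply, inner_zero_right,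
      Finset.sum_const_zero, add_zero]
    rfl
  rw [h1, h2, add_zero]
  exact Finset.sum_congr rfl fun i _ => real_inner_comm _ _

/-- The `C` part contributes `ν₀`. The coupling and its adjoint land in orthogonal blocks, so their
squared bounds add and `couplingBound` appears only once. -/
theorem norm_pdMap_sub_le (x y : PrimalDual H G Y X) :
    ‖P.pdMap x - P.pdMap y‖ ≤ P.beta * ‖x - y‖ := by
  rw [pdMap_sub]
  have hfst : ‖x.fst.fst - y.fst.fst‖ ≤ ‖x - y‖ :=
    (WithLp.norm_fst_le _ (x - y).fst).trans (WithLp.norm_fst_le _ (x - y))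
  refine (norm_add_le _ _).trans ?_
  rw [show P.beta = P.ν₀ + P.couplingBound from rfl, add_mul]
  refine add_le_add ?_ ?_
  · refine le_trans ?_ (mul_le_mul_of_nonneg_left hfst P.ν₀_nonneg)
    refine le_of_sq_le_sq ?_ (mul_nonneg P.ν₀_nonneg (norm_nonneg _))
    rw [WithLp.prod_norm_sq_eq_of_L2, mul_pow, PiLp.norm_sq_eq_of_L2]
    change ‖pairMk _ (0 : ∀ k, G k)‖ ^ 2 + ‖(0 : PairSpace X Y)‖ ^ 2 ≤ _
    rw [WithLp.prod_norm_sq_eq_of_L2]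
    change ‖WithLp.toLp 2 _‖ ^ 2 + ‖(0 : PiLp 2 G)‖ ^ 2 + ‖(0 : PairSpace X Y)‖ ^ 2 ≤ _
    rw [PiLp.norm_sq_eq_of_L2, norm_zero, norm_zero]
    simpa using P.C_lipschitz x.fst.fst.ofLp y.fst.fst.ofLp
  · refine le_of_sq_le_sq ?_ (mul_nonneg P.couplingBound_nonneg (norm_nonneg _))
    rw [WithLp.prod_norm_sq_eq_of_L2, mul_pow, WithLp.prod_norm_sq_eq_of_L2 (x - y)]
    change ‖P.couplingAdj (x - y).snd‖ ^ 2 + ‖-P.coupling (x - y).fst‖ ^ 2 ≤ _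
    rw [norm_neg]
    have h1 := pow_le_pow_left₀ (norm_nonneg _) (P.norm_couplingAdj_le (x - y).snd) 2
    have h2 := pow_le_pow_left₀ (norm_nonneg _) (P.norm_coupling_le (x - y).fst) 2
    rw [mul_pow] at h1 h2
    linarith

/-- The summand `y₁` from the `B` inverse becomes `x₂`, while the preimages `w₁`, `w₂` of the dual
vector under `N*` and `M*` become `v₁`, `v₂`. -/
theorem exists_zero_of_omega_nonempty (hΩ : P.Omega.Nonempty) :
    ∃ u : PrimalDual H G Y X, -P.pdMap u ∈ P.pdOp u := by
  obtain ⟨⟨x, v⟩, h₁, h₂⟩ := hΩ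
  simp only at h₁ h₂
  choose y₁ hy₁ y₂ hy₂ hy using fun k => Set.mem_add.1 (h₂ k)
  choose w₂ hw₂ hv₂ using hy₁
  choose w₁ hw₁ hv₁ using hy₂
  refine ⟨pdMk x y₁ w₁ w₂, ?_⟩
  rw [mem_pdOp_iff]
  refine ⟨⟨fun i => ?_, fun k => ?_⟩, fun k => ?_, fun k => ?_⟩
  · obtain ⟨a, ha, c, rfl, hac⟩ := Set.mem_add.1 (h₁ i)
    change -(P.C i x + ∑ k, (P.L k i).adjoint ((P.N k).adjoint (w₁ k))) + P.z i ∈ P.A i (x i)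
    simp_rw [hv₁]
    convert ha using 1
    rw [← sub_eq_iff_eq_add.2 hac.symm]
    abel
  · change -(0 + ((P.M k).adjoint (w₂ k) - (P.N k).adjoint (w₁ k))) = 0
    rw [hv₁, hv₂]
    simp
  · change w₁ k ∈ P.D k (- -(P.N k (∑ i, P.L k i (x i)) - P.N k (y₁ k)) - P.N k (P.r k))
    convert hw₁ k using 1
    rw [← map_sub, neg_neg, ← map_sub, sub_right_comm, ← hy k, add_sub_cancel_left]
  · change w₂ k ∈ P.B k (- -P.M k (y₁ k))
    rw [neg_neg]
    exact hw₂ k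

/-- The row of `x₂` carries the zero operator and so says `M* v₂ = N* v₁`. This lets one dual vector
serve both summands, `x₂` and `∑ L x₁ - r - x₂`. -/
theorem omega_of_zero {u : PrimalDual H G Y X} (hu : -P.pdMap u ∈ P.pdOp u) :
    (∀ k, (P.M k).adjoint (u.snd.snd k) = (P.N k).adjoint (u.snd.fst k)) ∧
      ((u.fst.fst.ofLp, fun k => (P.N k).adjoint (u.snd.fst k)) :
        (∀ i, H i) × (∀ k, G k)) ∈ P.Omega := by
  obtain ⟨⟨hA, h0⟩, hD, hB⟩ := (P.mem_pdOp_iff).1 hu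
  have hMN : ∀ k, (P.M k).adjoint (u.snd.snd k) = (P.N k).adjoint (u.snd.fst k) := by
    intro k
    have : -(0 + ((P.M k).adjoint (u.snd.snd k) - (P.N k).adjoint (u.snd.fst k))) = 0 := h0 k
    rwa [zero_add, neg_eq_zero, sub_eq_zero] at this
  refine ⟨hMN, fun i => ?_, fun k => ?_⟩
  · refine Set.mem_add.2 ⟨_, hA i, _, rfl, ?_⟩
    change -(P.C i u.fst.fst.ofLp + ∑ k, (P.L k i).adjoint ((P.N k).adjoint (u.snd.fst k)))
      + P.z i + P.C i u.fst.fst.ofLp = _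
    simp only
    abel
  · refine Set.mem_add.2 ⟨u.fst.snd k, ⟨u.snd.snd k, ?_, hMN k⟩,
      ∑ i, P.L k i (u.fst.fst i) - P.r k - u.fst.snd k, ⟨u.snd.fst k, ?_, rfl⟩,
      add_sub_cancel _ _⟩
    · have : u.snd.snd k ∈ P.B k (- -P.M k (u.fst.snd k)) := hB k
      rwa [neg_neg] at this
    · have : u.snd.fst k ∈ P.D k (- -(P.N k (∑ i, P.L k i (u.fst.fst i)) - P.N k (u.fst.snd k))
        - P.N k (P.r k)) := hD k
      convert this using 1
      rw [neg_neg, ← map_sub, ← map_sub]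
      exact congrArg (fun t => P.D k (P.N k t)) (sub_right_comm _ _ _)

end CompositeSystem

end System

/-! ### The iteration as a run in the primal-dual space -/

theorem summable_norm_of_components {I J : Type*} [Fintype I] [Fintype J] {U : I → Type*}
    {V : J → Type*} [∀ i, NormedAddCommGroup (U i)] [∀ j, NormedAddCommGroup (V j)]
    {f : ∀ i, ℕ → U i} {g : ∀ j, ℕ → V j}
    (hf : ∀ i, Summable fun n => ‖f i n‖) (hg : ∀ j, Summable fun n => ‖g j n‖) :
    Summable fun n => ‖(pairMk (fun i => f i n) fun j => g j n : PairSpace U V)‖ := by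
  refine Summable.of_nonneg_of_le (fun n => norm_nonneg _) (fun n => ?_)
    ((summable_sum (s := Finset.univ) fun i _ => hf i).add
      (summable_sum (s := Finset.univ) fun j _ => hg j))
  have hS : 0 ≤ ∑ i, ‖f i n‖ := Finset.sum_nonneg fun _ _ => norm_nonneg _
  have hT : 0 ≤ ∑ j, ‖g j n‖ := Finset.sum_nonneg fun _ _ => norm_nonneg _
  refine le_of_sq_le_sq ?_ (add_nonneg hS hT)
  rw [WithLp.prod_norm_sq_eq_of_L2, PiLp.norm_sq_eq_of_L2, PiLp.norm_sq_eq_of_L2]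
  have h1 : ∑ i, ‖f i n‖ ^ 2 ≤ (∑ i, ‖f i n‖) ^ 2 :=
    Finset.sum_sq_le_sq_sum_of_nonneg fun _ _ => norm_nonneg _
  have h2 : ∑ j, ‖g j n‖ ^ 2 ≤ (∑ j, ‖g j n‖) ^ 2 :=
    Finset.sum_sq_le_sq_sum_of_nonneg fun _ _ => norm_nonneg _
  refine (add_le_add h1 h2).trans ?_
  nlinarith [mul_nonneg hS hT]

theorem WithLp.norm_toLp_prod_le {E F : Type*} [NormedAddCommGroup E] [NormedAddCommGroup F]
    (x : E) (y : F) : ‖(WithLp.toLp 2 (x, y) : WithLp 2 (E × F))‖ ≤ ‖x‖ + ‖y‖ := by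
  refine le_of_sq_le_sq ?_ (by positivity)
  rw [WithLp.prod_norm_sq_eq_of_L2]
  change ‖x‖ ^ 2 + ‖y‖ ^ 2 ≤ _
  nlinarith [mul_nonneg (norm_nonneg x) (norm_nonneg y)]

theorem tendsto_zero_of_sum_nonneg {ι : Type*} [Fintype ι] {f : ι → ℕ → ℝ}
    (hf : ∀ i n, 0 ≤ f i n) {t : ℕ → ℝ} (h : ∀ n, ∑ i, f i n ≤ t n)
    (ht : Tendsto t atTop (𝓝 0)) (i : ι) : Tendsto (f i) atTop (𝓝 0) :=
  squeeze_zero (hf i) (fun n => (Finset.single_le_sum (fun j _ => hf j n) (Finset.mem_univ i)).trans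
    (h n)) ht

theorem summable_norm_neg_smul {E : Type*} [NormedAddCommGroup E] [NormedSpace ℝ E] {γ : ℕ → ℝ}
    {Γ : ℝ} (hγ : ∀ n, 0 ≤ γ n) (hΓ : ∀ n, γ n ≤ Γ) {f : ℕ → E} (hf : Summable fun n => ‖f n‖) :
    Summable fun n => ‖-(γ n • f n)‖ := by
  refine Summable.of_nonneg_of_le (fun n => norm_nonneg _) (fun n => ?_) (hf.mul_left Γ)
  rw [norm_neg, norm_smul, Real.norm_of_nonneg (hγ n)]
  exact mul_le_mul_of_nonneg_right (hΓ n) (norm_nonneg _)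

theorem mem_opResolvent_smul_iff {E : Type*} [NormedAddCommGroup E] [InnerProductSpace ℝ E]
    {A : E → Set E} {c : ℝ} {w y : E} :
    w ∈ opResolvent (fun x => c • A x) y ↔ ∃ a ∈ A w, y = w + c • a := by
  change y ∈ {w} + c • A w ↔ _
  rw [Set.singleton_add, ← Set.image_smul, Set.image_image]
  simp only [Set.mem_image, eq_comm]

theorem pd_ext {m s : ℕ} {H : Fin m → Type*} {G Y X : Fin s → Type*}
    {u w : PrimalDual H G Y X} (h₁ : ∀ i, u.fst.fst i = w.fst.fst i)
    (h₂ : ∀ k, u.fst.snd k = w.fst.snd k) (h₃ : ∀ k, u.snd.fst k = w.snd.fst k)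
    (h₄ : ∀ k, u.snd.snd k = w.snd.snd k) : u = w := by
  refine WithLp.ofLp_injective 2 (Prod.ext (WithLp.ofLp_injective 2 (Prod.ext ?_ ?_))
    (WithLp.ofLp_injective 2 (Prod.ext ?_ ?_)))
  · exact PiLp.ext h₁
  · exact PiLp.ext h₂
  · exact PiLp.ext h₃
  · exact PiLp.ext h₄

section Run

variable {m s : ℕ} {H : Fin m → Type*} {G Y X : Fin s → Type*}
variable [∀ i, NormedAddCommGroup (H i)] [∀ k, NormedAddCommGroup (G k)]
variable [∀ k, NormedAddCommGroup (Y k)] [∀ k, NormedAddCommGroup (X k)]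

theorem summable_norm_pdMk {x₁ : ∀ i, ℕ → H i} {x₂ : ∀ k, ℕ → G k} {v₁ : ∀ k, ℕ → X k}
    {v₂ : ∀ k, ℕ → Y k} (h₁ : ∀ i, Summable fun n => ‖x₁ i n‖)
    (h₂ : ∀ k, Summable fun n => ‖x₂ k n‖) (h₃ : ∀ k, Summable fun n => ‖v₁ k n‖)
    (h₄ : ∀ k, Summable fun n => ‖v₂ k n‖) :
    Summable fun n => ‖(pdMk (fun i => x₁ i n) (fun k => x₂ k n) (fun k => v₁ k n)
      fun k => v₂ k n : PrimalDual H G Y X)‖ :=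
  Summable.of_nonneg_of_le (fun _ => norm_nonneg _) (fun _ => WithLp.norm_toLp_prod_le _ _)
    ((summable_norm_of_components h₁ h₂).add (summable_norm_of_components h₃ h₄))

variable [∀ i, InnerProductSpace ℝ (H i)] [∀ i, CompleteSpace (H i)]
variable [∀ k, InnerProductSpace ℝ (G k)] [∀ k, CompleteSpace (G k)]
variable [∀ k, InnerProductSpace ℝ (Y k)] [∀ k, CompleteSpace (Y k)]
variable [∀ k, InnerProductSpace ℝ (X k)] [∀ k, CompleteSpace (X k)]

set_option maxHeartbeats 800000 in
theorem CompositeSystem.IsRun.exists_convergence {P : CompositeSystem H G Y X}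
    (hΩ : P.Omega.Nonempty) (hβ : 0 < P.beta) {e : ErrorSequences H G Y X} {ε : ℝ}
    (hε : ε ∈ Set.Ioo 0 (1 / (P.beta + 1))) {γ : ℕ → ℝ}
    (hγ : ∀ n, γ n ∈ Set.Icc ε ((1 - ε) / P.beta)) {T : Iterates H G Y X} (hT : P.IsRun e γ T) :
    ∃ p u : ℕ → PrimalDual H G Y X, (∀ n, u n ∈ P.pdOp (p n)) ∧
      (Summable fun n => ‖pdMk (fun i => T.x₁ i n - T.p₁₁ i n) (fun k => T.x₂ k n - T.p₁₂ k n)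
        (fun k => T.v₁ k n - T.p₂₁ k n) (fun k => T.v₂ k n - T.p₂₂ k n)‖ ^ 2) ∧
      Tendsto (fun n => pdMk (fun i => T.x₁ i n) (fun k => T.x₂ k n) (fun k => T.v₁ k n)
        (fun k => T.v₂ k n) - p n) atTop (𝓝 0) ∧
      ∃ z, -P.pdMap z ∈ P.pdOp z ∧
        (∀ y, Tendsto (fun n => inner ℝ y (pdMk (fun i => T.x₁ i n) (fun k => T.x₂ k n)
          (fun k => T.v₁ k n) (fun k => T.v₂ k n))) atTop (𝓝 (inner ℝ y z))) ∧
        Tendsto (fun n => inner ℝ (p n - z) (u n + P.pdMap (p n))) atTop (𝓝 0) := by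
  obtain ⟨hε0, hε1⟩ := hε
  have hε1' : ε ≤ 1 := hε1.le.trans (by rw [div_le_one (by linarith)]; linarith)
  have hγ0 : ∀ n, 0 < γ n := fun n => hε0.trans_le (hγ n).1
  have hγβ : ∀ n, γ n * P.beta ≤ 1 - ε := fun n => (le_div_iff₀ hβ).1 (hγ n).2
  choose w₁ hw₁ hp₁ using hT.p₁₁_eq
  choose w₃ hw₃ hp₃ using hT.p₂₁_eq
  choose w₄ hw₄ hp₄ using hT.p₂₂_eq
  simp only [mem_opResolvent_smul_iff] at hw₁ hw₃ hw₄
  choose a₁ ha₁ ha₁' using hw₁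
  choose d₃ hd₃ hd₃' using hw₃
  choose d₄ hd₄ hd₄' using hw₄
  -- Moreau's decomposition: multiplying the resolvent equation by `γ n` exhibits `d₃` as the exact
  -- backward step for the shifted inverse of `D`, with `w₃ + N r` as its operator value.
  have hd₃s : ∀ n k, T.s₂₁ k n = d₃ n k + γ n • (w₃ n k + P.N k (P.r k)) := fun n k => by
    have h := congrArg (fun t => γ n • t) (sub_eq_iff_eq_add.1 (hd₃' n k))
    simp only [smul_add, smul_inv_smul₀ (hγ0 n).ne'] at h
    rw [h, smul_add]
    abel
  have hd₄s : ∀ n k, T.s₂₂ k n = d₄ n k + γ n • w₄ n k := fun n k => by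
    have h := congrArg (fun t => γ n • t) (hd₄' n k)
    simp only [smul_add, smul_inv_smul₀ (hγ0 n).ne'] at h
    rw [h]
    abel
  have hp₃' : ∀ n k, T.p₂₁ k n = d₃ n k + -(γ n • e.b₂₁ k n) := fun n k => by
    rw [hp₃, hd₃s]
    simp only [smul_add]
    abel
  have hp₄' : ∀ n k, T.p₂₂ k n = d₄ n k + -(γ n • e.b₂₂ k n) := fun n k => by
    rw [hp₄, hd₄s]
    simp only [smul_add]
    abel
  let x : ℕ → PrimalDual H G Y X := fun n =>
    pdMk (fun i => T.x₁ i n) (fun k => T.x₂ k n) (fun k => T.v₁ k n) fun k => T.v₂ k n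
  let a : ℕ → PrimalDual H G Y X := fun n =>
    pdMk (fun i => e.a₁₁ i n) (fun k => -e.a₁₂ k n) (fun k => -e.a₂₁ k n) fun k => -e.a₂₂ k n
  -- The `x₂` row has a trivial backward step, hence no error; in the dual rows the errors sit
  -- inside the factor `-γ n`.
  let b : ℕ → PrimalDual H G Y X := fun n => pdMk (fun i => e.b₁₁ i n) (fun k => 0)
    (fun k => -(γ n • e.b₂₁ k n)) fun k => -(γ n • e.b₂₂ k n)
  let c : ℕ → PrimalDual H G Y X := fun n =>
    pdMk (fun i => e.c₁₁ i n) (fun k => -e.c₁₂ k n) (fun k => -e.c₂₁ k n) fun k => -e.c₂₂ k n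
  -- These are the exact backward points, on the graph of `pdOp`; the computed ones are `p n + b n`.
  let p : ℕ → PrimalDual H G Y X := fun n =>
    pdMk (fun i => w₁ n i) (fun k => T.p₁₂ k n) (fun k => d₃ n k) fun k => d₄ n k
  let u : ℕ → PrimalDual H G Y X := fun n =>
    pdMk (fun i => a₁ n i - P.z i) (fun k => 0) (fun k => w₃ n k + P.N k (P.r k)) fun k => w₄ n k
  have ha : Summable fun n => ‖a n‖ := summable_norm_pdMk e.a₁₁_summable
    (fun k => by simpa only [norm_neg] using e.a₁₂_summable k)
    (fun k => by simpa only [norm_neg] using e.a₂₁_summable k)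
    (fun k => by simpa only [norm_neg] using e.a₂₂_summable k)
  have hc : Summable fun n => ‖c n‖ := summable_norm_pdMk e.c₁₁_summable
    (fun k => by simpa only [norm_neg] using e.c₁₂_summable k)
    (fun k => by simpa only [norm_neg] using e.c₂₁_summable k)
    (fun k => by simpa only [norm_neg] using e.c₂₂_summable k)
  have hb : Summable fun n => ‖b n‖ := summable_norm_pdMk
    (x₂ := fun k _ => 0) (v₁ := fun k n => -(γ n • e.b₂₁ k n))
    (v₂ := fun k n => -(γ n • e.b₂₂ k n)) e.b₁₁_summable
    (fun k => by simpa only [norm_zero] using summable_zero)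
    (fun k => summable_norm_neg_smul (fun n => (hγ0 n).le) (fun n => (hγ n).2) (e.b₂₁_summable k))
    (fun k => summable_norm_neg_smul (fun n => (hγ0 n).le) (fun n => (hγ n).2) (e.b₂₂_summable k))
  have hu : ∀ n, u n ∈ P.pdOp (p n) := by
    intro n
    rw [P.mem_pdOp_iff]
    refine ⟨⟨fun i => ?_, fun k => rfl⟩, fun k => ?_, fun k => hd₄ n k⟩
    · change a₁ n i - P.z i + P.z i ∈ P.A i (w₁ n i)
      rw [sub_add_cancel]
      exact ha₁ n i
    · change d₃ n k ∈ P.D k (w₃ n k + P.N k (P.r k) - P.N k (P.r k))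
      rw [add_sub_cancel_right]
      exact hd₃ n k
  have hpb : ∀ n, p n + b n = pdMk (fun i => T.p₁₁ i n) (fun k => T.p₁₂ k n)
      (fun k => T.p₂₁ k n) fun k => T.p₂₂ k n := fun n =>
    pd_ext (fun i => (hp₁ n i).symm) (fun k => add_zero _) (fun k => (hp₃' n k).symm)
      fun k => (hp₄' n k).symm
  have hs : ∀ n, x n - γ n • (P.pdMap (x n) + a n) = p n + γ n • u n := by
    intro n
    refine pd_ext (fun i => ?_) (fun k => ?_) (fun k => ?_) fun k => ?_
    · change T.x₁ i n - γ n • (P.C i (fun j => T.x₁ j n)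
        + ∑ k, (P.L k i).adjoint ((P.N k).adjoint (T.v₁ k n)) + e.a₁₁ i n) =
        w₁ n i + γ n • (a₁ n i - P.z i)
      rw [← hT.s₁₁_eq, smul_sub, eq_sub_of_add_eq (ha₁' n i)]
      abel
    · change T.x₂ k n - γ n • (0 + ((P.M k).adjoint (T.v₂ k n) - (P.N k).adjoint (T.v₁ k n))
        + -e.a₁₂ k n) = T.p₁₂ k n + γ n • (0 : G k)
      rw [hT.p₁₂_eq]
      module
    · change T.v₁ k n - γ n • (-(P.N k (∑ i, P.L k i (T.x₁ i n)) - P.N k (T.x₂ k n))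
        + -e.a₂₁ k n) = d₃ n k + γ n • (w₃ n k + P.N k (P.r k))
      rw [← hd₃s, hT.s₂₁_eq, map_sum]
      module
    · change T.v₂ k n - γ n • (-P.M k (T.x₂ k n) + -e.a₂₂ k n) = d₄ n k + γ n • w₄ n k
      rw [← hd₄s, hT.s₂₂_eq]
      module
  have hx : ∀ n, x (n + 1) = γ n • (P.pdMap (x n) + a n) + (p n + b n)
      - γ n • (P.pdMap (p n + b n) + c n) := by
    intro n
    rw [hpb]
    refine pd_ext (fun i => ?_) (fun k => ?_) (fun k => ?_) fun k => ?_
    · change T.x₁ i (n + 1) = γ n • (P.C i (fun j => T.x₁ j n)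
        + ∑ k, (P.L k i).adjoint ((P.N k).adjoint (T.v₁ k n)) + e.a₁₁ i n) + T.p₁₁ i n
        - γ n • (P.C i (fun j => T.p₁₁ j n)
        + ∑ k, (P.L k i).adjoint ((P.N k).adjoint (T.p₂₁ k n)) + e.c₁₁ i n)
      rw [hT.x₁_succ, hT.q₁₁_eq, hT.s₁₁_eq]
      abel
    · change T.x₂ k (n + 1) = γ n • (0 + ((P.M k).adjoint (T.v₂ k n)
        - (P.N k).adjoint (T.v₁ k n)) + -e.a₁₂ k n) + T.p₁₂ k n
        - γ n • (0 + ((P.M k).adjoint (T.p₂₂ k n) - (P.N k).adjoint (T.p₂₁ k n)) + -e.c₁₂ k n)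
      rw [hT.x₂_succ, hT.q₁₂_eq, hT.p₁₂_eq]
      module
    · change T.v₁ k (n + 1) = γ n • (-(P.N k (∑ i, P.L k i (T.x₁ i n)) - P.N k (T.x₂ k n))
        + -e.a₂₁ k n) + T.p₂₁ k n
        - γ n • (-(P.N k (∑ i, P.L k i (T.p₁₁ i n)) - P.N k (T.p₁₂ k n)) + -e.c₂₁ k n)
      rw [hT.v₁_succ, hT.q₂₁_eq, hT.s₂₁_eq, map_sum (P.N k) (fun i => P.L k i (T.x₁ i n))]
      module
    · change T.v₂ k (n + 1) = γ n • (-P.M k (T.x₂ k n) + -e.a₂₂ k n) + T.p₂₂ k n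
        - γ n • (-P.M k (T.p₁₂ k n) + -e.c₂₂ k n)
      rw [hT.v₂_succ, hT.q₂₂_eq, hT.s₂₂_eq]
      module
  obtain ⟨hS, hd, z, hz, hweak, hlim⟩ := forward_backward_forward P.isMaximallyMonotoneOp_pdOp
    (fun y y' => by
      rw [P.inner_pdMap_sub]
      exact P.C_monotone y.fst.fst.ofLp y'.fst.fst.ofLp)
    P.norm_pdMap_sub_le (P.exists_zero_of_omega_nonempty hΩ) hε0 hε1' (fun n => (hγ n).1)
    (fun n => (hγ n).2) hγβ ha hb hc hu hs hx
  simp only [hpb] at hS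
  exact ⟨p, u, hu, hS, hd, z, hz, hweak, hlim⟩

end Run

/-- The nonnegative pieces of the primal-dual inclusion vanish along the iteration. -/
theorem CompositeSystem.tendsto_inner_components {m s : ℕ} {H : Fin m → Type*}
    {G Y X : Fin s → Type*}
    [∀ i, NormedAddCommGroup (H i)] [∀ i, InnerProductSpace ℝ (H i)] [∀ i, CompleteSpace (H i)]
    [∀ k, NormedAddCommGroup (G k)] [∀ k, InnerProductSpace ℝ (G k)] [∀ k, CompleteSpace (G k)]
    [∀ k, NormedAddCommGroup (Y k)] [∀ k, InnerProductSpace ℝ (Y k)] [∀ k, CompleteSpace (Y k)]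
    [∀ k, NormedAddCommGroup (X k)] [∀ k, InnerProductSpace ℝ (X k)] [∀ k, CompleteSpace (X k)]
    (P : CompositeSystem H G Y X) {p u : ℕ → PrimalDual H G Y X} {z : PrimalDual H G Y X}
    (hu : ∀ n, u n ∈ P.pdOp (p n)) (hz : -P.pdMap z ∈ P.pdOp z)
    (h : Tendsto (fun n => inner ℝ (p n - z) (u n + P.pdMap (p n))) atTop (𝓝 0)) :
    (∀ i, Tendsto (fun n => inner ℝ ((p n).fst.fst i - z.fst.fst i)
      ((u n).fst.fst i - (-P.pdMap z).fst.fst i)) atTop (𝓝 0)) ∧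
    Tendsto (fun n => ∑ i, inner ℝ (P.C i (p n).fst.fst.ofLp - P.C i z.fst.fst.ofLp)
      ((p n).fst.fst i - z.fst.fst i)) atTop (𝓝 0) ∧
    (∀ k, Tendsto (fun n => inner ℝ ((p n).snd.fst k - z.snd.fst k)
      ((u n).snd.fst k - (-P.pdMap z).snd.fst k)) atTop (𝓝 0)) ∧
    ∀ k, Tendsto (fun n => inner ℝ ((p n).snd.snd k - z.snd.snd k)
      ((u n).snd.snd k - (-P.pdMap z).snd.snd k)) atTop (𝓝 0) := by
  set y := -P.pdMap z with hy
  have hzM := (P.mem_pdOp_iff).1 hz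
  have huM := fun n => (P.mem_pdOp_iff).1 (hu n)
  have hA : ∀ i n, 0 ≤ inner ℝ ((p n).fst.fst i - z.fst.fst i) ((u n).fst.fst i - y.fst.fst i) :=
    fun i n => by
      simpa only [add_sub_add_right_eq_sub] using
        (P.A_maximal i).1 _ _ _ _ ((huM n).1.1 i) (hzM.1.1 i)
  have hD : ∀ k n, 0 ≤ inner ℝ ((p n).snd.fst k - z.snd.fst k) ((u n).snd.fst k - y.snd.fst k) :=
    fun k n => by
      simpa only [sub_sub_sub_cancel_right] using
        (P.D_maximal k).inv.1 _ _ _ _ ((huM n).2.1 k) (hzM.2.1 k)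
  have hB : ∀ k n, 0 ≤ inner ℝ ((p n).snd.snd k - z.snd.snd k) ((u n).snd.snd k - y.snd.snd k) :=
    fun k n => (P.B_maximal k).inv.1 _ _ _ _ ((huM n).2.2 k) (hzM.2.2 k)
  have hC : ∀ n, 0 ≤ ∑ i, inner ℝ (P.C i (p n).fst.fst.ofLp - P.C i z.fst.fst.ofLp)
      ((p n).fst.fst i - z.fst.fst i) := fun n => P.C_monotone _ _
  -- Adding and subtracting `P.pdMap z` compares `u n` with `y`, an element of `pdOp z`, so each
  -- block becomes a monotonicity pairing.
  have hsplit : ∀ n, inner ℝ (p n - z) (u n + P.pdMap (p n)) =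
      (∑ i, inner ℝ ((p n).fst.fst i - z.fst.fst i) ((u n).fst.fst i - y.fst.fst i)) +
      (∑ k, inner ℝ ((p n).snd.fst k - z.snd.fst k) ((u n).snd.fst k - y.snd.fst k) +
      ∑ k, inner ℝ ((p n).snd.snd k - z.snd.snd k) ((u n).snd.snd k - y.snd.snd k)) +
      ∑ i, inner ℝ (P.C i (p n).fst.fst.ofLp - P.C i z.fst.fst.ofLp)
        ((p n).fst.fst i - z.fst.fst i) := by
    intro n
    have h0 : ∑ k, inner ℝ ((p n).fst.snd k - z.fst.snd k) ((u n).fst.snd k - y.fst.snd k) = 0 :=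
      Finset.sum_eq_zero fun k _ => by rw [(huM n).1.2 k, hzM.1.2 k, sub_zero, inner_zero_right]
    have h1 : u n + P.pdMap (p n) = (u n - y) + (P.pdMap (p n) - P.pdMap z) := by
      rw [hy]
      abel
    rw [h1, inner_add_right, P.inner_pdMap_sub]
    congr 1
    rw [← add_zero (∑ i, inner ℝ ((p n).fst.fst i - z.fst.fst i) _), ← h0]
    simp only [WithLp.prod_inner_apply, PiLp.inner_apply]
    rfl
  have hSA := fun n => Finset.sum_nonneg fun i (_ : i ∈ Finset.univ) => hA i n
  have hSD := fun n => Finset.sum_nonneg fun i (_ : i ∈ Finset.univ) => hD i n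
  have hSB := fun n => Finset.sum_nonneg fun i (_ : i ∈ Finset.univ) => hB i n
  refine ⟨tendsto_zero_of_sum_nonneg hA (fun n => ?_) h, squeeze_zero hC (fun n => ?_) h,
    tendsto_zero_of_sum_nonneg hD (fun n => ?_) h, tendsto_zero_of_sum_nonneg hB (fun n => ?_) h⟩
  all_goals
    rw [hsplit n]
    linarith [hSA n, hSD n, hSB n, hC n]

/-! ### Passage to the components -/

theorem theorem2p1 {m s : ℕ} (hm : 0 < m) (hs : 0 < s)
    (H : Fin m → Type*) (G Y X : Fin s → Type*)
    [∀ i, NormedAddCommGroup (H i)] [∀ i, InnerProductSpace ℝ (H i)] [∀ i, CompleteSpace (H i)]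
    [∀ k, NormedAddCommGroup (G k)] [∀ k, InnerProductSpace ℝ (G k)] [∀ k, CompleteSpace (G k)]
    [∀ k, NormedAddCommGroup (Y k)] [∀ k, InnerProductSpace ℝ (Y k)] [∀ k, CompleteSpace (Y k)]
    [∀ k, NormedAddCommGroup (X k)] [∀ k, InnerProductSpace ℝ (X k)] [∀ k, CompleteSpace (X k)]
    (P : CompositeSystem H G Y X) (hΩ : P.Omega.Nonempty) (hβ : 0 < P.beta)
    (e : ErrorSequences H G Y X)
    (ε : ℝ) (hε : ε ∈ Set.Ioo 0 (1 / (P.beta + 1)))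
    (γ : ℕ → ℝ) (hγ : ∀ n, γ n ∈ Set.Icc ε ((1 - ε) / P.beta))
    (T : Iterates H G Y X) (hT : P.IsRun e γ T) :
    (∀ i, Summable fun n => ‖T.x₁ i n - T.p₁₁ i n‖ ^ 2) ∧
    (∀ k, Summable fun n => ‖T.x₂ k n - T.p₁₂ k n‖ ^ 2) ∧
    (∀ k, Summable fun n => ‖T.v₁ k n - T.p₂₁ k n‖ ^ 2) ∧
    (∀ k, Summable fun n => ‖T.v₂ k n - T.p₂₂ k n‖ ^ 2) ∧
    ∃ (xb₁ : ∀ i, H i) (xb₂ : ∀ k, G k) (vb₁ : ∀ k, X k) (vb₂ : ∀ k, Y k),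
      (∀ i, WeaklyConvergesTo (T.x₁ i) (xb₁ i)) ∧
      (∀ k, WeaklyConvergesTo (T.x₂ k) (xb₂ k)) ∧
      (∀ k, WeaklyConvergesTo (T.v₁ k) (vb₁ k)) ∧
      (∀ k, WeaklyConvergesTo (T.v₂ k) (vb₂ k)) ∧
      (∀ k, (P.M k).adjoint (vb₂ k) = (P.N k).adjoint (vb₁ k)) ∧
      (xb₁, fun k => (P.N k).adjoint (vb₁ k)) ∈ P.Omega ∧
      (∀ j, IsUniformlyMonotoneOpAt (P.A j) (xb₁ j) → Tendsto (T.x₁ j) atTop (𝓝 (xb₁ j))) ∧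
      (IsUniformlyMonotoneOpAt P.jointC (WithLp.toLp 2 xb₁) →
        ∀ i, Tendsto (T.x₁ i) atTop (𝓝 (xb₁ i))) ∧
      (∀ j, (∃ φ : ℝ≥0 → ℝ≥0∞, IsModulus φ ∧ ∀ x : ∀ i, H i,
          (φ ‖x j - xb₁ j‖₊ : EReal) ≤
            ((∑ i, inner ℝ (P.C i x - P.C i xb₁) (x i - xb₁ i) : ℝ) : EReal)) →
        Tendsto (T.x₁ j) atTop (𝓝 (xb₁ j))) ∧
      (∀ j, IsUniformlyMonotoneOpAt (opInv (P.D j)) (vb₁ j) →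
        Tendsto (T.v₁ j) atTop (𝓝 (vb₁ j))) ∧
      (∀ j, IsUniformlyMonotoneOpAt (opInv (P.B j)) (vb₂ j) →
        Tendsto (T.v₂ j) atTop (𝓝 (vb₂ j))) := by
  obtain ⟨p, u, hu, hS, hd, z, hz, hweak, hlim⟩ := hT.exists_convergence hΩ hβ hε hγ
  let w : ℕ → PrimalDual H G Y X := fun n => pdMk (fun i => T.x₁ i n - T.p₁₁ i n)
    (fun k => T.x₂ k n - T.p₁₂ k n) (fun k => T.v₁ k n - T.p₂₁ k n) fun k => T.v₂ k n - T.p₂₂ k n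
  let f₁ : ∀ i, PrimalDual H G Y X →L[ℝ] H i := fun i => (PiLp.proj 2 H i ∘L
    WithLp.fstL 2 ℝ (PiLp 2 H) (PiLp 2 G)) ∘L WithLp.fstL 2 ℝ (PairSpace H G) (PairSpace X Y)
  let f₂ : ∀ k, PrimalDual H G Y X →L[ℝ] G k := fun k => (PiLp.proj 2 G k ∘L
    WithLp.sndL 2 ℝ (PiLp 2 H) (PiLp 2 G)) ∘L WithLp.fstL 2 ℝ (PairSpace H G) (PairSpace X Y)
  let g₁ : ∀ k, PrimalDual H G Y X →L[ℝ] X k := fun k => (PiLp.proj 2 X k ∘L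
    WithLp.fstL 2 ℝ (PiLp 2 X) (PiLp 2 Y)) ∘L WithLp.sndL 2 ℝ (PairSpace H G) (PairSpace X Y)
  let g₂ : ∀ k, PrimalDual H G Y X →L[ℝ] Y k := fun k => (PiLp.proj 2 Y k ∘L
    WithLp.sndL 2 ℝ (PiLp 2 X) (PiLp 2 Y)) ∘L WithLp.sndL 2 ℝ (PairSpace H G) (PairSpace X Y)
  obtain ⟨hMN, hΩz⟩ := P.omega_of_zero hz
  obtain ⟨hA₀, hC₀, hD₀, hB₀⟩ := P.tendsto_inner_components hu hz hlim
  have hzM := (P.mem_pdOp_iff).1 hz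
  have huM := fun n => (P.mem_pdOp_iff).1 (hu n)
  -- Uniform monotonicity controls the exact backward points, which lie on the operator graphs; `x -
  -- p → 0` carries their norm limits to the iterates.
  have hx₁ : ∀ i, Tendsto (fun n => (p n).fst.fst i) atTop (𝓝 (z.fst.fst i)) →
      Tendsto (T.x₁ i) atTop (𝓝 (z.fst.fst i)) := fun i h => by
    have h1 := (((f₁ i).continuous.tendsto 0).comp hd).add h
    rw [map_zero, zero_add] at h1
    exact h1.congr fun n => sub_add_cancel (T.x₁ i n) ((p n).fst.fst i)
  have hv₁ : ∀ k, Tendsto (fun n => (p n).snd.fst k) atTop (𝓝 (z.snd.fst k)) →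
      Tendsto (T.v₁ k) atTop (𝓝 (z.snd.fst k)) := fun k h => by
    have h1 := (((g₁ k).continuous.tendsto 0).comp hd).add h
    rw [map_zero, zero_add] at h1
    exact h1.congr fun n => sub_add_cancel (T.v₁ k n) ((p n).snd.fst k)
  have hv₂ : ∀ k, Tendsto (fun n => (p n).snd.snd k) atTop (𝓝 (z.snd.snd k)) →
      Tendsto (T.v₂ k) atTop (𝓝 (z.snd.snd k)) := fun k h => by
    have h1 := (((g₂ k).continuous.tendsto 0).comp hd).add h
    rw [map_zero, zero_add] at h1
    exact h1.congr fun n => sub_add_cancel (T.v₂ k n) ((p n).snd.snd k)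
  refine ⟨fun i => ?_, fun k => ?_, fun k => ?_, fun k => ?_, z.fst.fst.ofLp, z.fst.snd.ofLp,
    z.snd.fst.ofLp, z.snd.snd.ofLp, fun i => weaklyConvergesTo_map hweak (f₁ i),
    fun k => weaklyConvergesTo_map hweak (f₂ k), fun k => weaklyConvergesTo_map hweak (g₁ k),
    fun k => weaklyConvergesTo_map hweak (g₂ k), hMN, hΩz, fun j hj => ?_, fun hj i => ?_,
    fun j hj => ?_, fun j hj => ?_, fun j hj => ?_⟩
  · exact Summable.of_nonneg_of_le (fun n => sq_nonneg _) (fun n => pow_le_pow_left₀ (norm_nonneg _)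
      ((PiLp.norm_apply_le (w n).fst.fst i).trans ((WithLp.norm_fst_le _ _).trans
        (WithLp.norm_fst_le _ _))) 2) hS
  · exact Summable.of_nonneg_of_le (fun n => sq_nonneg _) (fun n => pow_le_pow_left₀ (norm_nonneg _)
      ((PiLp.norm_apply_le (w n).fst.snd k).trans ((WithLp.norm_snd_le _ _).trans
        (WithLp.norm_fst_le _ _))) 2) hS
  · exact Summable.of_nonneg_of_le (fun n => sq_nonneg _) (fun n => pow_le_pow_left₀ (norm_nonneg _)
      ((PiLp.norm_apply_le (w n).snd.fst k).trans ((WithLp.norm_fst_le _ _).trans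
        (WithLp.norm_snd_le _ _))) 2) hS
  · exact Summable.of_nonneg_of_le (fun n => sq_nonneg _) (fun n => pow_le_pow_left₀ (norm_nonneg _)
      ((PiLp.norm_apply_le (w n).snd.snd k).trans ((WithLp.norm_snd_le _ _).trans
        (WithLp.norm_snd_le _ _))) 2) hS
  · refine hx₁ j (tendsto_of_uniformlyMonotoneOpAt hj (hzM.1.1 j) (fun n => (huM n).1.1 j) ?_)
    simpa only [add_sub_add_right_eq_sub] using hA₀ j
  · refine hx₁ i ?_
    -- The modulus here controls the norm of the whole primal block, so all its components converge
    -- together.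
    have h1 : Tendsto (fun n => (p n).fst.fst) atTop (𝓝 (WithLp.toLp 2 z.fst.fst.ofLp)) := by
      refine tendsto_of_uniformlyMonotoneOpAt hj (Set.mem_singleton _)
        (fun n => Set.mem_singleton _) (hC₀.congr fun n => ?_)
      rw [PiLp.inner_apply]
      exact Finset.sum_congr rfl fun i _ => real_inner_comm _ _
    exact ((PiLp.proj (𝕜 := ℝ) 2 H i).continuous.tendsto _).comp h1
  · obtain ⟨φ, hφ, hj⟩ := hj
    refine hx₁ j ?_
    rw [tendsto_iff_norm_sub_tendsto_zero, ← tendsto_zero_iff_norm_tendsto_zero]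
    exact tendsto_zero_of_isModulus hφ hC₀ fun n => hj (p n).fst.fst.ofLp
  · refine hv₁ j (tendsto_of_uniformlyMonotoneOpAt hj (hzM.2.1 j) (fun n => (huM n).2.1 j) ?_)
    simpa only [sub_sub_sub_cancel_right] using hD₀ j
  · exact hv₂ j (tendsto_of_uniformlyMonotoneOpAt hj (hzM.2.2 j) (fun n => (huM n).2.2 j) (hB₀ j))
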